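/- Let $\mu,\gamma>0$, let $k:[0,\infty)\to\mathbb R$ be non-decreasing and bounded, and let $q$ be the distribution function of a probability measure on $[0,\infty)$, with $q$ continuous on $[0,\infty)$. Second-price auctions arrive at the times $T_1<T_2<\dots$ of a Poisson process of intensity $\mu$; the prices to beat $C_1,C_2,\dots$ are i.i.d. with distribution function $q$ and independent of the arrivals. A bidding policy is a measurable function $b:[0,\infty)\to[0,\infty)$: the buyer bids $b(a)$ when the age, i.e. the time elapsed since his last won auction, is $a$, and he wins the $i$-th auction if $b(\tau(T_i))>C_i$, where $\tau(T_i)$ is the age when the $i$-th auction takes place; winning resets the age to $0$. Starting from age $\tau$, the value of the policy is $$V_b(\tau)=\mathbb E\sum_{i\ge1}e^{-\gamma T_i}\bigl(k(\tau(T_i))-C_i\bigr)\mathbf 1\{b(\tau(T_i))>C_i\}\in[-\infty,\infty),$$ and $V^\star(\tau)=\sup_b V_b(\tau)$, the supremum being over all bidding policies. Put $p(b)=q(b)b-\int_0^b q(t)\,dt$ and $\pi(v)=q(v)v-p(v)$, and for $v\in\mathbb R$ consider on $[0,\infty)$ the self-parametrized Cauchy problem $$(\mathcal F_v)\qquad \dot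 Y_t=\gamma Y_t-\mu\,\pi(k(t)+v-Y_t),\qquad Y_0=v,$$ where a solution is a continuous function on $[0,\infty)$ with $Y_0=v$ that satisfies the differential equation at every time at which $k$ is continuous (so a classical solution if $k$ is continuous). Then for every $v\in\mathbb R$ the problem $(\mathcal F_v)$ has a unique solution $Z^v$ on $[0,\infty)$; the number $V^\star(0)$ is finite; and $V^\star(0)$ is the unique $v\in\mathbb R$ for which $Z^v(t)$ has a finite limit as $t\to\infty$. -/

import Mathlib

open MeasureTheory ProbabilityTheory Filter Topology Set

noncomputable section

namespace RepeatedAuction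

/-- Sample space: `(ω i).1` is the waiting time between auctions `i - 1` and `i` (between time `0`
and the first auction if `i = 0`), and `(ω i).2` is the price to beat at auction `i`. -/
abbrev Sample : Type := ℕ → ℝ × ℝ

/-- Auctions arrive as a Poisson process of intensity `rate` (independent exponential waiting
times), the prices to beat are independent with law `ν`, and independent of the arrivals. -/
def auctionLaw (rate : ℝ) (ν : Measure ℝ) : Measure Sample :=
  Measure.infinitePi fun _ : ℕ => (expMeasure rate).prod ν

/-- Waiting time before auction `i`. -/
def waiting (ω : Sample) (i : ℕ) : ℝ := (ω i).1

/-- Price to beat at auction `i`. -/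
def price (ω : Sample) (i : ℕ) : ℝ := (ω i).2

/-- Calendar time of auction `i`. -/
def auctionTime (ω : Sample) (i : ℕ) : ℝ := ∑ j ∈ Finset.range (i + 1), waiting ω j

open Classical in
/-- Age at auction `i` (time elapsed since the last won auction), when the age at time `0` is `τ`
and the bidder bids `b a` at age `a`. It restarts from `0` after every auction that is won. -/
def age (b : ℝ → ℝ) (τ : ℝ) (ω : Sample) : ℕ → ℝ
  | 0 => τ + waiting ω 0
  | i + 1 => (if price ω i < b (age b τ ω i) then 0 else age b τ ω i) + waiting ω (i + 1)

open Classical in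
/-- Discounted profit made at auction `i`. -/
def profit (k : ℝ → ℝ) (γ : ℝ) (b : ℝ → ℝ) (τ : ℝ) (ω : Sample) (i : ℕ) : ℝ :=
  if price ω i < b (age b τ ω i) then
    Real.exp (-γ * auctionTime ω i) * (k (age b τ ω i) - price ω i)
  else 0

/-- Bidding functions: measurable and nonnegative. (Only the values at ages `≥ 0` matter.) -/
def IsPolicy (b : ℝ → ℝ) : Prop := Measurable b ∧ ∀ a, 0 ≤ b a

/-- The value of a bidding function at age `τ`: the expectation of the sum of the discounted
profits, as the expected total gain minus the expected total loss. For bounded `k` the first term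
is finite, so the difference is meaningful; it is `-∞` if the expected loss is infinite. -/
def value (k : ℝ → ℝ) (ν : Measure ℝ) (rate γ : ℝ) (b : ℝ → ℝ) (τ : ℝ) : EReal :=
  ((∫⁻ ω, ∑' i, ENNReal.ofReal (profit k γ b τ ω i) ∂(auctionLaw rate ν) : ENNReal) : EReal)
    - ((∫⁻ ω, ∑' i, ENNReal.ofReal (-profit k γ b τ ω i) ∂(auctionLaw rate ν) : ENNReal) : EReal)

/-- The optimal value function `V⋆`. -/
def optimalValue (k : ℝ → ℝ) (ν : Measure ℝ) (rate γ : ℝ) (τ : ℝ) : EReal :=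
  ⨆ (b : ℝ → ℝ) (_ : IsPolicy b), value k ν rate γ b τ

/-- Average payment when bidding `b` in a second price auction against a price with distribution
function `q`. -/
def payment (q : ℝ → ℝ) (b : ℝ) : ℝ := q b * b - ∫ t in (0 : ℝ)..b, q t

/-- Expected utility of bidding `b` with value `v`. -/
def utility (q : ℝ → ℝ) (v b : ℝ) : ℝ := q b * v - payment q b

/-- Expected profit of a truthful bidder of value `v` in a one shot auction. -/
def oneShotProfit (q : ℝ → ℝ) (v : ℝ) : ℝ := utility q v v

/-- The right-hand side `Φ(t, y, lam) = γ y - rate * π(k t + lam - y)`. -/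
def dynamics (k q : ℝ → ℝ) (rate γ : ℝ) (t y lam : ℝ) : ℝ :=
  γ * y - rate * oneShotProfit q (k t + lam - y)

/-- `Y` solves the Cauchy problem `Y' t = Φ(t, Y t, lam)`, `Y 0 = y₀` on `[0, ∞)`. Since `k` is only
assumed monotone, it may jump at countably many times, where no derivative can be asked for: `Y` is
continuous and satisfies the equation at every time where `k` is continuous. If `k` is continuous,
this is the classical notion. -/
structure IsSolution (k q : ℝ → ℝ) (rate γ y₀ lam : ℝ) (Y : ℝ → ℝ) : Prop where
  initial : Y 0 = y₀
  continuousOn : ContinuousOn Y (Ici 0)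
  hasDeriv : ∀ t, 0 ≤ t → ContinuousWithinAt k (Ici 0) t →
    HasDerivWithinAt Y (dynamics k q rate γ t (Y t) lam) (Ici 0) t

/-- `Y` solves the self-parametrized problem `F_v`: the initial value is also the parameter. -/
def IsSelfSolution (k q : ℝ → ℝ) (rate γ v : ℝ) (Y : ℝ → ℝ) : Prop :=
  IsSolution k q rate γ v v Y

end RepeatedAuction

end

noncomputable section

namespace RepeatedAuction

/-! Put ρ = `rate / (rate + γ)` and G_W(t) = W t + π(k t + W 0 - W t), which is E max(W t, k t - C +
W 0): at an auction at age t, one loses and keeps W t or wins at price C and restarts. Conditioning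
on the first auction gives the Bellman equation W t = rate ∫_t^∞ e^{-(rate+γ)(r-t)} G_W(r) dr. Since
π is nondecreasing and 1-Lipschitz, W ↦ G_W is nonexpansive for the sup norm, so the right-hand side
is a ρ-contraction and has a bounded continuous fixed point W (`exists_bellman_solution`). The same
contraction estimate shows that W is nondecreasing and nonnegative.

Differentiating the Bellman equation gives exactly the problem F_v with v = W 0, and W converges
because it is monotone and bounded. Conversely, a solution Z of F_v with a finite limit is bounded
on [0, ∞), so an integrating factor turns the differential equation back into the Bellman equation
(`IsSelfSolution.eq_discountedFuture`); the contraction forces Z = W on [0, ∞), hence v = W 0.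

It remains to see that W is the optimal value (`optimalValue_eq`). By induction on the number of
auctions, no policy gains more than its losses plus W, while the bid (k + W 0 - W)⁺ achieves this up
to an error ρⁿ M. Gains and losses are kept apart in `ENNReal`, so that infinite expected losses are
allowed. Well-posedness of F_v for every v is Picard iteration in an exponentially weighted norm. -/

/-- A function bounded above on `s` whose nonnegative upper bounds all improve by a factor `ρ < 1`
is nonpositive on `s`. -/
theorem nonpos_of_forall_le_mul {α : Type*} {f : α → ℝ} {s : Set α} {M ρ : ℝ} (hρ₀ : 0 ≤ ρ)
    (hρ₁ : ρ < 1) (hM : ∀ x ∈ s, f x ≤ M)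
    (h : ∀ B, 0 ≤ B → (∀ x ∈ s, f x ≤ B) → ∀ x ∈ s, f x ≤ ρ * B) : ∀ x ∈ s, f x ≤ 0 := by
  have key : ∀ n : ℕ, ∀ x ∈ s, f x ≤ ρ ^ n * |M| := by
    intro n
    induction n with
    | zero => intro x hx; simpa using (hM x hx).trans (le_abs_self M)
    | succ n ih =>
      intro x hx
      have := h _ (by positivity) ih x hx
      rwa [pow_succ', mul_assoc]
  intro x hx
  have hlim : Tendsto (fun n : ℕ => ρ ^ n * |M|) atTop (𝓝 (0 * |M|)) :=
    (tendsto_pow_atTop_nhds_zero_of_lt_one hρ₀ hρ₁).mul_const _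
  rw [zero_mul] at hlim
  exact ge_of_tendsto' hlim fun n => key n x hx

/-! ### The one-shot profit π as the integral of the distribution function -/

section OneShot

theorem oneShotProfit_eq_integral (q : ℝ → ℝ) (v : ℝ) :
    oneShotProfit q v = ∫ t in (0 : ℝ)..v, q t := by
  simp [oneShotProfit, utility, payment]

variable (ν : Measure ℝ)

/-- The one shot profit `π` of a truthful bidder against a price of law `ν`. -/
abbrev truthfulProfit (v : ℝ) : ℝ := oneShotProfit (fun x => cdf ν x) v

/-- Since the integrand lies in [0, 1], this makes π nondecreasing and 1-Lipschitz, the two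
properties behind every estimate below. -/
theorem truthfulProfit_sub (x y : ℝ) :
    truthfulProfit ν y - truthfulProfit ν x = ∫ t in x..y, cdf ν t := by
  have hi : ∀ a b : ℝ, IntervalIntegrable (fun t => cdf ν t) volume a b :=
    fun a b => (monotone_cdf ν).intervalIntegrable
  simp only [truthfulProfit, oneShotProfit_eq_integral]
  exact intervalIntegral.integral_interval_sub_left (hi _ _) (hi _ _)

theorem truthfulProfit_mono : Monotone (truthfulProfit ν) := by
  intro x y hxy
  have := truthfulProfit_sub ν x y
  have h0 : 0 ≤ ∫ t in x..y, cdf ν t :=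
    intervalIntegral.integral_nonneg hxy fun t _ => cdf_nonneg ν t
  linarith

theorem truthfulProfit_sub_le {x y : ℝ} (hxy : x ≤ y) :
    truthfulProfit ν y - truthfulProfit ν x ≤ y - x := by
  rw [truthfulProfit_sub]
  calc ∫ t in x..y, cdf ν t ≤ ∫ _ in x..y, (1 : ℝ) :=
        intervalIntegral.integral_mono_on hxy (monotone_cdf ν).intervalIntegrable
          intervalIntegrable_const fun t _ => cdf_le_one ν t
    _ = y - x := by simp

theorem abs_truthfulProfit_sub_le (x y : ℝ) :
    |truthfulProfit ν x - truthfulProfit ν y| ≤ |x - y| := by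
  rcases le_total x y with h | h
  · have h1 := truthfulProfit_mono ν h
    have h2 := truthfulProfit_sub_le ν h
    rw [abs_of_nonpos (by linarith), abs_of_nonpos (by linarith)]; linarith
  · have h1 := truthfulProfit_mono ν h
    have h2 := truthfulProfit_sub_le ν h
    rw [abs_of_nonneg (by linarith), abs_of_nonneg (by linarith)]; linarith

theorem truthfulProfit_zero : truthfulProfit ν 0 = 0 := by
  simp [truthfulProfit, oneShotProfit_eq_integral]

theorem abs_truthfulProfit_le (x : ℝ) : |truthfulProfit ν x| ≤ |x| := by
  simpa [truthfulProfit_zero] using abs_truthfulProfit_sub_le ν x 0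

@[fun_prop]
theorem continuous_truthfulProfit : Continuous (truthfulProfit ν) :=
  (LipschitzWith.of_dist_le_mul (K := 1) fun x y => by
    simpa [Real.dist_eq] using abs_truthfulProfit_sub_le ν x y).continuous

theorem ae_price_nonneg (hν : ν (Iio 0) = 0) : ∀ᵐ c ∂ν, 0 ≤ c := by
  rw [ae_iff]; simpa [Iio] using hν

variable [IsProbabilityMeasure ν]

theorem cdf_eq_zero_of_neg (hν : ν (Iio 0) = 0) {x : ℝ} (hx : x < 0) : cdf ν x = 0 := by
  have : ν (Iic x) = 0 := measure_mono_null (fun y hy => lt_of_le_of_lt hy hx) hν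
  rw [cdf_eq_real, measureReal_def, this, ENNReal.toReal_zero]

theorem truthfulProfit_of_nonpos (hν : ν (Iio 0) = 0) {v : ℝ} (hv : v ≤ 0) :
    truthfulProfit ν v = 0 := by
  simp only [truthfulProfit, oneShotProfit_eq_integral]
  rw [intervalIntegral.integral_symm, intervalIntegral.integral_of_le hv,
    integral_Ioc_eq_integral_Ioo,
    setIntegral_eq_zero_of_forall_eq_zero fun x hx => cdf_eq_zero_of_neg ν hν hx.2, neg_zero]

theorem truthfulProfit_nonneg (hν : ν (Iio 0) = 0) (v : ℝ) : 0 ≤ truthfulProfit ν v := by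
  rw [← truthfulProfit_of_nonpos ν hν (min_le_right v 0)]
  exact truthfulProfit_mono ν (min_le_left v 0)

/-- The truthful profit is the expectation of the positive part of `v - C`. -/
theorem lintegral_ofReal_sub (hν : ν (Iio 0) = 0) (v : ℝ) :
    ∫⁻ c, ENNReal.ofReal (v - c) ∂ν = ENNReal.ofReal (truthfulProfit ν v) := by
  rcases le_total v 0 with hv | hv
  · rw [truthfulProfit_of_nonpos ν hν hv, ENNReal.ofReal_zero]
    refine lintegral_eq_zero_of_ae_eq_zero ?_
    filter_upwards [ae_price_nonneg ν hν] with c hc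
    simp; linarith
  -- Layer cake: for c ≥ 0 the positive part of v - c is the length of {t ∈ (0, v] : c ≤ t}; Tonelli
  -- then exchanges t and c.
  · have h1 : ENNReal.ofReal (truthfulProfit ν v) = ∫⁻ t in Ioc 0 v, ν (Iic t) := by
      simp only [truthfulProfit, oneShotProfit_eq_integral]
      rw [intervalIntegral.integral_of_le hv, ofReal_integral_eq_lintegral_ofReal]
      · simp_rw [ofReal_cdf]
      · exact ((monotone_cdf ν).intervalIntegrable (a := 0) (b := v)).1
      · exact ae_of_all _ fun t => cdf_nonneg ν t
    have hmeas : Measurable (Function.uncurry fun (t c : ℝ) =>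
        (Ici c).indicator (fun _ => (1 : ENNReal)) t) := by
      have : (Function.uncurry fun (t c : ℝ) => (Ici c).indicator (fun _ => (1 : ENNReal)) t)
          = {p : ℝ × ℝ | p.2 ≤ p.1}.indicator fun _ => 1 := by
        ext ⟨t, c⟩; simp [indicator]
      rw [this]
      exact measurable_const.indicator (measurableSet_le measurable_snd measurable_fst)
    have h2 : ∀ t : ℝ, ν (Iic t) = ∫⁻ c, (Ici c).indicator (fun _ => (1 : ENNReal)) t ∂ν := by
      intro t
      rw [← lintegral_indicator_one measurableSet_Iic]
      congr 1
    rw [h1]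
    simp_rw [h2]
    rw [lintegral_lintegral_swap hmeas.aemeasurable]
    refine lintegral_congr_ae ?_
    filter_upwards [ae_price_nonneg ν hν] with c hc
    have : ∫⁻ t in Ioc 0 v, (Ici c).indicator (fun _ => (1 : ENNReal)) t
        = volume (Ici c ∩ Ioc 0 v) := by
      rw [lintegral_indicator measurableSet_Ici, Measure.restrict_restrict measurableSet_Ici]
      simp
    rw [this]
    refine le_antisymm ?_ ?_
    · rw [← Real.volume_Ioc]
      exact measure_mono fun t ht => ⟨ht.1.le, lt_of_le_of_lt hc ht.1, ht.2⟩
    · rw [← Real.volume_Icc]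
      exact measure_mono fun t ht => ⟨ht.1, ht.2.2⟩

end OneShot

/-! ### Discounted integrals over the future -/

section Discounting

/-- Integral of `g` over the future of `t`, discounted at rate `β`. -/
def discountedFuture (β : ℝ) (g : ℝ → ℝ) (t : ℝ) : ℝ :=
  Real.exp (β * t) * ∫ r in Ioi t, Real.exp (-β * r) * g r

variable {β : ℝ} {g g₁ g₂ : ℝ → ℝ} {M M₁ M₂ : ℝ}

theorem integrableOn_exp_neg_mul (hβ : 0 < β) (hg : Measurable g) (hM : ∀ r, |g r| ≤ M) (t : ℝ) :
    IntegrableOn (fun r => Real.exp (-β * r) * g r) (Ioi t) :=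
  (exp_neg_integrableOn_Ioi t hβ).mul_bdd (c := M) hg.aestronglyMeasurable
    (ae_of_all _ fun r => by simpa using hM r)

theorem integral_exp_neg_Ioi (hβ : 0 < β) (t : ℝ) :
    Real.exp (β * t) * ∫ r in Ioi t, Real.exp (-β * r) = 1 / β := by
  rw [integral_exp_mul_Ioi (by linarith)]
  have : Real.exp (β * t) * Real.exp (-β * t) = 1 := by rw [← Real.exp_add]; simp
  rw [mul_div_assoc', mul_neg, this, neg_div_neg_eq]

/-- The kernel e^{-β(r-t)} has mass 1/β on (t, ∞). Multiplied by `rate` with β = `rate + γ`, this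
gives the contraction factor. -/
theorem discountedFuture_sub_le (hβ : 0 < β) (hg₁ : Measurable g₁) (hM₁ : ∀ r, |g₁ r| ≤ M₁)
    (hg₂ : Measurable g₂) (hM₂ : ∀ r, |g₂ r| ≤ M₂) {t B : ℝ} (h : ∀ r, t < r → g₁ r - g₂ r ≤ B) :
    discountedFuture β g₁ t - discountedFuture β g₂ t ≤ B / β := by
  have i₁ := integrableOn_exp_neg_mul hβ hg₁ hM₁ t
  have i₂ := integrableOn_exp_neg_mul hβ hg₂ hM₂ t
  unfold discountedFuture
  rw [← mul_sub, ← integral_sub i₁ i₂]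
  calc Real.exp (β * t) * ∫ r in Ioi t, (Real.exp (-β * r) * g₁ r - Real.exp (-β * r) * g₂ r)
      ≤ Real.exp (β * t) * ∫ r in Ioi t, Real.exp (-β * r) * B := by
        refine mul_le_mul_of_nonneg_left ?_ (Real.exp_pos _).le
        refine setIntegral_mono_on (i₁.sub i₂) ((exp_neg_integrableOn_Ioi t hβ).mul_const B)
          measurableSet_Ioi fun r hr => ?_
        rw [← mul_sub]
        exact mul_le_mul_of_nonneg_left (h r hr) (Real.exp_pos _).le
    _ = B / β := by
        rw [integral_mul_const, ← mul_assoc, integral_exp_neg_Ioi hβ]; ring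

theorem abs_discountedFuture_sub_le (hβ : 0 < β) (hg₁ : Measurable g₁) (hM₁ : ∀ r, |g₁ r| ≤ M₁)
    (hg₂ : Measurable g₂) (hM₂ : ∀ r, |g₂ r| ≤ M₂) {t B : ℝ}
    (h : ∀ r, t < r → |g₁ r - g₂ r| ≤ B) :
    |discountedFuture β g₁ t - discountedFuture β g₂ t| ≤ B / β := by
  rw [abs_sub_le_iff]
  exact ⟨discountedFuture_sub_le hβ hg₁ hM₁ hg₂ hM₂ fun r hr => (abs_sub_le_iff.1 (h r hr)).1,
    discountedFuture_sub_le hβ hg₂ hM₂ hg₁ hM₁ fun r hr => (abs_sub_le_iff.1 (h r hr)).2⟩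

theorem discountedFuture_zero (t : ℝ) : discountedFuture β (fun _ => 0) t = 0 := by
  simp [discountedFuture]

theorem discountedFuture_eq_sub_intervalIntegral (hβ : 0 < β) (hg : Measurable g)
    (hM : ∀ r, |g r| ≤ M) (t : ℝ) :
    discountedFuture β g t = Real.exp (β * t) *
      ((∫ r in Ioi 0, Real.exp (-β * r) * g r) - ∫ r in (0 : ℝ)..t, Real.exp (-β * r) * g r) := by
  rw [discountedFuture, ← intervalIntegral.integral_Ioi_sub_Ioi'
    (integrableOn_exp_neg_mul hβ hg hM 0) (integrableOn_exp_neg_mul hβ hg hM t)]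
  congr 1; ring

theorem intervalIntegrable_exp_neg_mul (hβ : 0 < β) (hg : Measurable g)
    (hM : ∀ r, |g r| ≤ M) (a b : ℝ) :
    IntervalIntegrable (fun r => Real.exp (-β * r) * g r) volume a b :=
  ⟨(integrableOn_exp_neg_mul hβ hg hM a).mono_set Ioc_subset_Ioi_self,
    (integrableOn_exp_neg_mul hβ hg hM b).mono_set Ioc_subset_Ioi_self⟩

theorem continuous_discountedFuture (hβ : 0 < β) (hg : Measurable g) (hM : ∀ r, |g r| ≤ M) :
    Continuous (discountedFuture β g) := by
  have := intervalIntegral.continuous_primitive (intervalIntegrable_exp_neg_mul hβ hg hM) 0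
  rw [funext (discountedFuture_eq_sub_intervalIntegral hβ hg hM)]
  fun_prop

theorem hasDerivAt_discountedFuture (hβ : 0 < β) (hg : Measurable g) (hM : ∀ r, |g r| ≤ M)
    {t : ℝ} (ht : ContinuousAt g t) :
    HasDerivAt (discountedFuture β g) (β * discountedFuture β g t - g t) t := by
  have h1 : HasDerivAt (fun u => ∫ r in (0 : ℝ)..u, Real.exp (-β * r) * g r)
      (Real.exp (-β * t) * g t) t :=
    intervalIntegral.integral_hasDerivAt_right (intervalIntegrable_exp_neg_mul hβ hg hM 0 t)
      (Measurable.stronglyMeasurable (by fun_prop)).stronglyMeasurableAtFilter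
      (ContinuousAt.mul (by fun_prop) ht)
  have h2 : HasDerivAt (fun u => Real.exp (β * u)) (Real.exp (β * t) * β) t := by
    simpa using ((hasDerivAt_id t).const_mul β).exp
  have h3 := h2.mul (h1.const_sub (∫ r in Ioi 0, Real.exp (-β * r) * g r))
  have hfun := funext (discountedFuture_eq_sub_intervalIntegral hβ hg hM)
  rw [hfun]
  refine h3.congr_deriv ?_
  have : Real.exp (β * t) * Real.exp (-β * t) = 1 := by rw [← Real.exp_add]; simp
  beta_reduce
  linear_combination (-g t) * this

/-- Discounting is translation invariant. This serves to compare W with its shifts, and to pass from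
waiting times to ages. -/
theorem discountedFuture_comp_add (h t : ℝ) :
    discountedFuture β (fun r => g (r + h)) t = discountedFuture β g (t + h) := by
  have : ∫ r in Ioi t, Real.exp (-β * (r + h)) * g (r + h) =
      ∫ r in Ioi (t + h), Real.exp (-β * r) * g r := by
    rw [← (measurePreserving_add_right volume h).setIntegral_preimage_emb
      (MeasurableEquiv.addRight h).measurableEmbedding (fun r => Real.exp (-β * r) * g r)]
    simp
  unfold discountedFuture
  rw [← this, ← integral_const_mul, ← integral_const_mul]
  congr 1
  ext r
  rw [← mul_assoc, ← mul_assoc, ← Real.exp_add, ← Real.exp_add]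
  ring_nf

end Discounting

/-! ### Nonexpansiveness of the one-auction operator -/

section Continuation

variable (k : ℝ → ℝ) (ν : Measure ℝ)

/-- Expected optimal value right after an auction that takes place at age `t`, if `W` is the
continuation value. -/
def afterAuction (W : ℝ → ℝ) (t : ℝ) : ℝ := W t + truthfulProfit ν (k t + W 0 - W t)

variable {k ν}

/-- In W t + π(k t + W 0 - W t), a slope s ∈ [0, 1] of π puts weight 1 - s on W t and s on W 0. The
weights sum to one, so a common bound on both differences survives; monotonicity in k comes from s ≥
0. -/
theorem afterAuction_sub_le {k₁ k₂ W₁ W₂ : ℝ → ℝ} {t B : ℝ} (hk : k₁ t ≤ k₂ t)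
    (h : W₁ t - W₂ t ≤ B) (h₀ : W₁ 0 - W₂ 0 ≤ B) :
    afterAuction k₁ ν W₁ t - afterAuction k₂ ν W₂ t ≤ B := by
  unfold afterAuction
  rcases le_total (k₁ t + W₁ 0 - W₁ t) (k₂ t + W₂ 0 - W₂ t) with h1 | h1
  · have := truthfulProfit_mono ν h1
    linarith
  · have := truthfulProfit_sub_le ν h1
    linarith

theorem abs_afterAuction_sub_le {W₁ W₂ : ℝ → ℝ} {t B : ℝ}
    (h : |W₁ t - W₂ t| ≤ B) (h₀ : |W₁ 0 - W₂ 0| ≤ B) :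
    |afterAuction k ν W₁ t - afterAuction k ν W₂ t| ≤ B := by
  rw [abs_sub_le_iff] at *
  exact ⟨afterAuction_sub_le le_rfl h.1 h₀.1, afterAuction_sub_le le_rfl h.2 h₀.2⟩

theorem abs_afterAuction_le {W : ℝ → ℝ} {t K M : ℝ} (hk : |k t| ≤ K) (h : |W t| ≤ M)
    (h₀ : |W 0| ≤ M) : |afterAuction k ν W t| ≤ K + 3 * M := by
  have h1 := abs_truthfulProfit_le ν (k t + W 0 - W t)
  have h2 : |k t + W 0 - W t| ≤ K + 2 * M := by
    rw [abs_le] at *; constructor <;> linarith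
  have h3 := h1.trans h2
  unfold afterAuction
  rw [abs_le] at h3 h ⊢
  constructor <;> linarith

theorem measurable_afterAuction (hk : Measurable k) {W : ℝ → ℝ} (hW : Measurable W) :
    Measurable (afterAuction k ν W) := by
  unfold afterAuction
  have := (continuous_truthfulProfit ν).measurable
  exact hW.add (this.comp ((hk.add_const _).sub hW))

end Continuation

/-! ### The Bellman equation: existence, monotonicity and sign -/

section FixedPoint

variable {k : ℝ → ℝ} {K rate γ : ℝ}

/-- The dynamic programming equation has a bounded continuous solution. -/
theorem exists_bellman_solution (ν : Measure ℝ) (hk : Measurable k) (hK : ∀ t, |k t| ≤ K)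
    (hrate : 0 < rate) (hγ : 0 < γ) :
    ∃ (W : ℝ → ℝ) (M : ℝ), Continuous W ∧ (∀ t, |W t| ≤ M) ∧
      ∀ t, W t = rate * discountedFuture (rate + γ) (afterAuction k ν W) t := by
  have hβ : 0 < rate + γ := by positivity
  have hb : ∀ W : BoundedContinuousFunction ℝ ℝ, ∀ t,
      |afterAuction k ν W t| ≤ K + 3 * ‖W‖ := fun W t =>
    abs_afterAuction_le (hK t) (by simpa using W.norm_coe_le_norm t)
      (by simpa using W.norm_coe_le_norm 0)
  have hm : ∀ W : BoundedContinuousFunction ℝ ℝ, Measurable (afterAuction k ν W) :=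
    fun W => measurable_afterAuction hk W.continuous.measurable
  let T : BoundedContinuousFunction ℝ ℝ → BoundedContinuousFunction ℝ ℝ := fun W =>
    BoundedContinuousFunction.ofNormedAddCommGroup
      (fun t => rate * discountedFuture (rate + γ) (afterAuction k ν W) t)
      ((continuous_discountedFuture hβ (hm W) (hb W)).const_mul rate)
      (rate * ((K + 3 * ‖W‖) / (rate + γ))) (fun t => by
        rw [Real.norm_eq_abs, abs_mul, abs_of_pos hrate]
        refine mul_le_mul_of_nonneg_left ?_ hrate.le
        have := abs_discountedFuture_sub_le hβ (hm W) (hb W) (g₂ := fun _ => 0) (M₂ := 0)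
          measurable_const (by simp) (t := t) (B := K + 3 * ‖W‖) (fun r _ => by simpa using hb W r)
        simpa [discountedFuture_zero] using this)
  have hT : ContractingWith (⟨rate / (rate + γ), by positivity⟩ : NNReal) T := by
    constructor
    · change rate / (rate + γ) < 1
      rw [div_lt_one hβ]; linarith
    · refine LipschitzWith.of_dist_le_mul fun W₁ W₂ => ?_
      change _ ≤ rate / (rate + γ) * dist W₁ W₂
      rw [BoundedContinuousFunction.dist_le (by positivity)]
      intro t
      change dist (rate * _) (rate * _) ≤ _
      rw [Real.dist_eq, ← mul_sub, abs_mul, abs_of_pos hrate, div_mul_eq_mul_div, mul_div_assoc]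
      refine mul_le_mul_of_nonneg_left ?_ hrate.le
      refine abs_discountedFuture_sub_le hβ (hm W₁) (hb W₁) (hm W₂) (hb W₂) fun r _ =>
        abs_afterAuction_sub_le ?_ ?_
      · simpa [Real.dist_eq] using W₁.dist_coe_le_dist (g := W₂) r
      · simpa [Real.dist_eq] using W₁.dist_coe_le_dist (g := W₂) 0
  refine ⟨hT.fixedPoint, ‖hT.fixedPoint‖, hT.fixedPoint.continuous,
    fun t => by simpa using hT.fixedPoint.norm_coe_le_norm t, fun t => ?_⟩
  exact (DFunLike.congr_fun hT.fixedPoint_isFixedPt t).symm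

variable {ν : Measure ℝ} {W : ℝ → ℝ} {M : ℝ}

/-- W is compared with its shift by h: an upper bound B ≥ 0 of W t - W (t + h) improves to ρB. Both
sides contain the same unshifted W 0, so only the monotonicity of k is needed. -/
theorem monotone_of_bellman (hk : Monotone k) (hK : ∀ t, |k t| ≤ K)
    (hrate : 0 < rate) (hγ : 0 < γ) (hWm : Measurable W) (hM : ∀ t, |W t| ≤ M)
    (hW : ∀ t, W t = rate * discountedFuture (rate + γ) (afterAuction k ν W) t) : Monotone W := by
  have hβ : 0 < rate + γ := by positivity
  intro a b hab
  obtain ⟨h, hh, rfl⟩ : ∃ h, 0 ≤ h ∧ b = a + h := ⟨b - a, by linarith, by ring⟩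
  have key := nonpos_of_forall_le_mul (f := fun t => W t - W (t + h)) (s := univ) (M := 2 * M)
    (ρ := rate / (rate + γ)) (by positivity) (by rw [div_lt_one hβ]; linarith)
    (fun t _ => by
      have h1 := abs_le.1 (hM t); have h2 := abs_le.1 (hM (t + h)); linarith)
    (fun B hB hle t _ => ?_) a (mem_univ _)
  · linarith
  have hGm := measurable_afterAuction (ν := ν) hk.measurable hWm
  have hGb : ∀ r, |afterAuction k ν W r| ≤ K + 3 * M :=
    fun r => abs_afterAuction_le (hK r) (hM r) (hM 0)
  have := discountedFuture_sub_le hβ hGm hGb (g₂ := fun r => afterAuction k ν W (r + h))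
    (hGm.comp (measurable_add_const h)) (fun r => hGb (r + h)) (t := t) (B := B) (fun r _ => by
      unfold afterAuction
      have h2 := hle r (mem_univ _)
      have h3 : k r ≤ k (r + h) := hk (by linarith)
      beta_reduce at h2
      -- In the first case the π-terms help and the bound on W remains; in the second the Lipschitz
      -- bound cancels W and leaves k r - k (r + h) ≤ 0 ≤ B.
      rcases le_total (k r + W 0 - W r) (k (r + h) + W 0 - W (r + h)) with h4 | h4
      · have := truthfulProfit_mono ν h4
        linarith
      · have := truthfulProfit_sub_le ν h4
        linarith)
  rw [discountedFuture_comp_add] at this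
  rw [hW t, hW (t + h), ← mul_sub, div_mul_eq_mul_div, mul_div_assoc]
  exact mul_le_mul_of_nonneg_left this hrate.le

/-- As π ≥ 0, G_W ≥ W, so any bound B ≥ 0 of -W improves to ρB. -/
theorem nonneg_of_bellman [IsProbabilityMeasure ν] (hν : ν (Iio 0) = 0) (hk : Measurable k)
    (hK : ∀ t, |k t| ≤ K) (hrate : 0 < rate) (hγ : 0 < γ) (hWm : Measurable W)
    (hM : ∀ t, |W t| ≤ M)
    (hW : ∀ t, W t = rate * discountedFuture (rate + γ) (afterAuction k ν W) t) (t : ℝ) :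
    0 ≤ W t := by
  have hβ : 0 < rate + γ := by positivity
  have key := nonpos_of_forall_le_mul (f := fun t => - W t) (s := univ) (M := M)
    (ρ := rate / (rate + γ)) (by positivity) (by rw [div_lt_one hβ]; linarith)
    (fun t _ => by have h1 := abs_le.1 (hM t); linarith)
    (fun B hB hle t _ => ?_) t (mem_univ _)
  · linarith
  have hGm := measurable_afterAuction (ν := ν) hk hWm
  have hGb : ∀ r, |afterAuction k ν W r| ≤ K + 3 * M :=
    fun r => abs_afterAuction_le (hK r) (hM r) (hM 0)
  have := discountedFuture_sub_le hβ (g₁ := fun _ => 0) (M₁ := 0) measurable_const (by simp)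
    hGm hGb (t := t) (B := B) (fun r _ => by
      have h1 := hle r (mem_univ _)
      have h2 := truthfulProfit_nonneg ν hν (k r + W 0 - W r)
      unfold afterAuction
      linarith)
  rw [discountedFuture_zero, zero_sub] at this
  rw [hW t, div_mul_eq_mul_div, mul_div_assoc, ← mul_neg]
  exact mul_le_mul_of_nonneg_left this hrate.le

end FixedPoint

/-! ### Well-posedness of the Cauchy problem -/

section Cauchy

variable {k : ℝ → ℝ} {K rate γ y₀ lam : ℝ}

theorem IsSolution.congr_left {k' q Y : ℝ → ℝ} (h : IsSolution k q rate γ y₀ lam Y)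
    (hk : EqOn k' k (Ici 0)) : IsSolution k' q rate γ y₀ lam Y where
  initial := h.initial
  continuousOn := h.continuousOn
  hasDeriv t ht hc := by
    have := h.hasDeriv t ht (hc.congr (fun x hx => (hk hx).symm) (hk ht).symm)
    simpa only [dynamics, hk ht] using this

theorem IsSolution.congr_right {q Y Y' : ℝ → ℝ} (h : IsSolution k q rate γ y₀ lam Y)
    (hY : EqOn Y' Y (Ici 0)) : IsSolution k q rate γ y₀ lam Y' where
  initial := by rw [hY (mem_Ici.2 le_rfl), h.initial]
  continuousOn := h.continuousOn.congr hY
  hasDeriv t ht hc := by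
    rw [hY ht]
    exact (h.hasDeriv t ht hc).congr hY (hY ht)

/-- A function constant to the left of 0 loses nothing by one-sided continuity at 0, so two-sided
derivatives of integrals are available there too. -/
theorem continuousAt_of_continuousWithinAt_Ici (hk : ∀ t, k (max t 0) = k t) {t : ℝ} (ht : 0 ≤ t)
    (h : ContinuousWithinAt k (Ici 0) t) : ContinuousAt k t := by
  have hmax : ContinuousAt (fun t : ℝ => max t 0) t := by fun_prop
  have h' : ContinuousWithinAt k (Ici 0) (max t 0) := by rwa [max_eq_left ht]
  have := h'.tendsto.comp (tendsto_nhdsWithin_iff.2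
    ⟨hmax.tendsto, Eventually.of_forall fun x => le_max_right x 0⟩)
  refine Tendsto.congr hk ?_
  rw [hk] at this
  exact this

variable (ν : Measure ℝ)

theorem measurable_dynamics (hk : Measurable k) {Y : ℝ → ℝ} (hY : Measurable Y) :
    Measurable fun t => dynamics k (fun x => cdf ν x) rate γ t (Y t) lam := by
  have := (continuous_truthfulProfit ν).measurable
  exact (hY.const_mul γ).sub ((this.comp ((hk.add_const lam).sub hY)).const_mul rate)

theorem abs_dynamics_sub_le (hrate : 0 < rate) (hγ : 0 < γ) (t x y : ℝ) :
    |dynamics k (fun x => cdf ν x) rate γ t x lam - dynamics k (fun x => cdf ν x) rate γ t y lam|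
      ≤ (rate + γ) * |x - y| := by
  have h := abs_truthfulProfit_sub_le ν (k t + lam - y) (k t + lam - x)
  have e : k t + lam - y - (k t + lam - x) = x - y := by ring
  rw [e] at h
  unfold dynamics
  calc _ = |γ * (x - y) + rate * (truthfulProfit ν (k t + lam - y)
        - truthfulProfit ν (k t + lam - x))| := by congr 1; ring
    _ ≤ |γ * (x - y)| + |rate * (truthfulProfit ν (k t + lam - y)
        - truthfulProfit ν (k t + lam - x))| := abs_add_le _ _
    _ ≤ _ := by
      rw [abs_mul, abs_mul, abs_of_pos hrate, abs_of_pos hγ]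
      have := mul_le_mul_of_nonneg_left h hrate.le
      linarith

theorem abs_dynamics_zero_le (hK : ∀ t, |k t| ≤ K) (hrate : 0 < rate) (t : ℝ) :
    |dynamics k (fun x => cdf ν x) rate γ t 0 lam| ≤ rate * (K + |lam|) := by
  have h := (abs_truthfulProfit_le ν (k t + lam - 0)).trans
    ((by simpa using abs_add_le (k t) lam : |k t + lam - 0| ≤ |k t| + |lam|).trans
      (add_le_add_left (hK t) _))
  unfold dynamics
  rw [mul_zero, zero_sub, abs_neg, abs_mul, abs_of_pos hrate]
  exact mul_le_mul_of_nonneg_left h hrate.le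

theorem abs_dynamics_le (hK : ∀ t, |k t| ≤ K) (hrate : 0 < rate) (hγ : 0 < γ) (t y : ℝ) :
    |dynamics k (fun x => cdf ν x) rate γ t y lam| ≤ (rate + γ) * |y| + rate * (K + |lam|) := by
  have h1 := abs_dynamics_sub_le (k := k) (lam := lam) ν hrate hγ t y 0
  have h2 := abs_dynamics_zero_le (k := k) (lam := lam) (γ := γ) ν hK hrate t
  rw [sub_zero] at h1
  have h3 := abs_sub_abs_le_abs_sub (dynamics k (fun x => cdf ν x) rate γ t y lam)
    (dynamics k (fun x => cdf ν x) rate γ t 0 lam)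
  linarith

theorem intervalIntegrable_dynamics (hk : Measurable k) (hK : ∀ t, |k t| ≤ K) (hrate : 0 < rate)
    (hγ : 0 < γ) {Y : ℝ → ℝ} (hY : Continuous Y) (a b : ℝ) :
    IntervalIntegrable (fun t => dynamics k (fun x => cdf ν x) rate γ t (Y t) lam) volume a b := by
  have hb : IntervalIntegrable (fun t => (rate + γ) * |Y t| + rate * (K + |lam|)) volume a b :=
    Continuous.intervalIntegrable (by fun_prop) _ _
  exact hb.mono_fun' (measurable_dynamics ν hk hY.measurable).aestronglyMeasurable
    (ae_of_all _ fun t => abs_dynamics_le ν hK hrate hγ t (Y t))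

theorem IsSolution.hasDerivAt {Y : ℝ → ℝ}
    (h : IsSolution k (fun x => cdf ν x) rate γ y₀ lam Y) {t : ℝ} (ht : 0 < t)
    (hc : ContinuousAt k t) :
    HasDerivAt Y (dynamics k (fun x => cdf ν x) rate γ t (Y t) lam) t :=
  (h.hasDeriv t ht.le hc.continuousWithinAt).hasDerivAt (Ici_mem_nhds ht)

/-- A monotone k has only countably many discontinuities, and the fundamental theorem of calculus
tolerates a countable exceptional set for a continuous Y. -/
theorem IsSolution.sub_eq_integral (hk : Monotone k) (hK : ∀ t, |k t| ≤ K) (hrate : 0 < rate)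
    (hγ : 0 < γ) {Y : ℝ → ℝ} (hY : Continuous Y)
    (h : IsSolution k (fun x => cdf ν x) rate γ y₀ lam Y) {t : ℝ} (ht : 0 ≤ t) :
    Y t - y₀ = ∫ s in (0 : ℝ)..t, dynamics k (fun x => cdf ν x) rate γ s (Y s) lam := by
  rw [← h.initial]
  exact (integral_eq_of_hasDerivAt_off_countable_of_le Y _ ht hk.countable_not_continuousAt
    hY.continuousOn (fun s hs => h.hasDerivAt ν hs.1.1 (not_not.1 hs.2))
    (intervalIntegrable_dynamics ν hk.measurable hK hrate hγ hY _ _)).symm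

/-- In the norm weighted by e^{-Lt}, integration from 0 gains a factor 1/L. The dynamics are
Lipschitz in y with constant `rate + γ`, so L = 2(rate + γ) makes the Picard map a 1/2-contraction
on all of [0, ∞). -/
theorem abs_integral_le_of_le_exp {L C t : ℝ} (hL : 0 < L) (hC : 0 ≤ C) (ht : 0 ≤ t) {h : ℝ → ℝ}
    (hh : ∀ s ∈ Icc 0 t, |h s| ≤ C * Real.exp (L * s)) :
    Real.exp (-(L * t)) * |∫ s in (0 : ℝ)..t, h s| ≤ C / L := by
  have h1 : |∫ s in (0 : ℝ)..t, h s| ≤ ∫ s in (0 : ℝ)..t, C * Real.exp (L * s) := by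
    rw [← Real.norm_eq_abs]
    exact intervalIntegral.norm_integral_le_of_norm_le ht
      (ae_of_all _ fun s hs => hh s (Ioc_subset_Icc_self hs))
      ((by fun_prop : Continuous fun s => C * Real.exp (L * s)).intervalIntegrable _ _)
  have h2 : ∫ s in (0 : ℝ)..t, C * Real.exp (L * s) = C / L * (Real.exp (L * t) - 1) := by
    rw [intervalIntegral.integral_const_mul, intervalIntegral.integral_comp_mul_left _ hL.ne']
    simp; ring
  have h3 : Real.exp (-(L * t)) * Real.exp (L * t) = 1 := by rw [← Real.exp_add]; simp
  have hCL : 0 ≤ C / L := by positivity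
  calc _ ≤ Real.exp (-(L * t)) * (C / L * Real.exp (L * t)) := by
        refine mul_le_mul_of_nonneg_left ?_ (Real.exp_pos _).le
        rw [h2] at h1
        nlinarith
    _ = C / L := by rw [mul_left_comm, h3, mul_one]

theorem IsSolution.eqOn (hk : Monotone k) (hK : ∀ t, |k t| ≤ K) (hrate : 0 < rate)
    (hγ : 0 < γ) {Y₁ Y₂ : ℝ → ℝ} (h₁ : IsSolution k (fun x => cdf ν x) rate γ y₀ lam Y₁)
    (h₂ : IsSolution k (fun x => cdf ν x) rate γ y₀ lam Y₂) : EqOn Y₁ Y₂ (Ici 0) := by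
  -- Composing with `max t 0` makes the solutions continuous on the whole line without changing them
  -- on [0, ∞).
  wlog hc : Continuous Y₁ ∧ Continuous Y₂ generalizing Y₁ Y₂
  · have hmax : Continuous fun t : ℝ => max t 0 := by fun_prop
    have e : ∀ Y : ℝ → ℝ, EqOn (fun t => Y (max t 0)) Y (Ici 0) := fun Y t ht => by
      simp only [max_eq_left (mem_Ici.1 ht)]
    have := this (h₁.congr_right (e Y₁)) (h₂.congr_right (e Y₂))
      ⟨h₁.continuousOn.comp_continuous hmax fun t => le_max_right t 0,
        h₂.continuousOn.comp_continuous hmax fun t => le_max_right t 0⟩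
    exact fun t ht => by rw [← e Y₁ ht, ← e Y₂ ht, this ht]
  obtain ⟨hc₁, hc₂⟩ := hc
  intro T hT
  have hΛ : 0 < rate + γ := by positivity
  obtain ⟨M, hM⟩ := (isCompact_Icc (a := (0 : ℝ)) (b := T)).exists_bound_of_continuousOn
    (f := fun t => Real.exp (-(2 * (rate + γ) * t)) * |Y₁ t - Y₂ t|) (by fun_prop)
  have key := nonpos_of_forall_le_mul
    (f := fun t => Real.exp (-(2 * (rate + γ) * t)) * |Y₁ t - Y₂ t|) (s := Icc 0 T) (M := M)
    (ρ := 1 / 2) (by norm_num) (by norm_num) (fun t ht => (le_abs_self _).trans (hM t ht))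
    (fun B hB hle t ht => ?_) T ⟨hT, le_rfl⟩
  · have := Real.exp_pos (-(2 * (rate + γ) * T))
    have h0 : |Y₁ T - Y₂ T| ≤ 0 := by
      by_contra hcon
      exact absurd key (not_le.2 (mul_pos this (not_le.1 hcon)))
    exact sub_eq_zero.1 (abs_eq_zero.1 (le_antisymm h0 (abs_nonneg _)))
  have e : Y₁ t - Y₂ t = ∫ s in (0 : ℝ)..t, (dynamics k (fun x => cdf ν x) rate γ s (Y₁ s) lam -
      dynamics k (fun x => cdf ν x) rate γ s (Y₂ s) lam) := by
    rw [intervalIntegral.integral_sub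
      (intervalIntegrable_dynamics ν hk.measurable hK hrate hγ hc₁ _ _)
      (intervalIntegrable_dynamics ν hk.measurable hK hrate hγ hc₂ _ _),
      ← h₁.sub_eq_integral ν hk hK hrate hγ hc₁ ht.1,
      ← h₂.sub_eq_integral ν hk hK hrate hγ hc₂ ht.1]
    ring
  have := abs_integral_le_of_le_exp (L := 2 * (rate + γ)) (C := (rate + γ) * B) (by positivity)
    (by positivity) ht.1
    (h := fun s => dynamics k (fun x => cdf ν x) rate γ s (Y₁ s) lam -
      dynamics k (fun x => cdf ν x) rate γ s (Y₂ s) lam) (fun s hs => by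
      refine (abs_dynamics_sub_le ν hrate hγ s (Y₁ s) (Y₂ s)).trans ?_
      rw [mul_assoc]
      refine mul_le_mul_of_nonneg_left ?_ hΛ.le
      have h1 := hle s ⟨hs.1, hs.2.trans ht.2⟩
      rw [Real.exp_neg] at h1
      exact (inv_mul_le_iff₀' (Real.exp_pos _)).1 h1)
  rw [← e] at this
  refine this.trans (le_of_eq ?_)
  field_simp

theorem exists_isSolution (hk : Monotone k) (hK : ∀ t, |k t| ≤ K)
    (hext : ∀ t, k (max t 0) = k t) (hrate : 0 < rate) (hγ : 0 < γ) (y₀ lam : ℝ) :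
    ∃ Y, IsSolution k (fun x => cdf ν x) rate γ y₀ lam Y := by
  have hΛ : 0 < rate + γ := by positivity
  have hL : 0 < 2 * (rate + γ) := by positivity
  set L := 2 * (rate + γ) with hLdef
  have hK0 : 0 ≤ K := (abs_nonneg _).trans (hK 0)
  have hexp : ∀ t : ℝ, Real.exp (-(L * t)) * Real.exp (L * t) = 1 := fun t => by
    rw [← Real.exp_add]; simp
  -- The unknown is U = e^{-Lt} Y, which turns the weighted norm into the sup norm; F U is the
  -- right-hand side along Y.
  let F : BoundedContinuousFunction ℝ ℝ → ℝ → ℝ := fun U s =>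
    dynamics k (fun x => cdf ν x) rate γ s (Real.exp (L * s) * U s) lam
  have hF : ∀ (U : BoundedContinuousFunction ℝ ℝ) a b, IntervalIntegrable (F U) volume a b :=
    fun U a b => intervalIntegrable_dynamics ν hk.measurable hK hrate hγ
      (Y := fun s => Real.exp (L * s) * U s) (by fun_prop) a b
  have hFc : ∀ U : BoundedContinuousFunction ℝ ℝ, Continuous fun t => ∫ s in (0 : ℝ)..t, F U s :=
    fun U => intervalIntegral.continuous_primitive (hF U) 0
  let S : BoundedContinuousFunction ℝ ℝ → BoundedContinuousFunction ℝ ℝ := fun U =>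
    BoundedContinuousFunction.ofNormedAddCommGroup
      (fun t => Real.exp (-(L * max t 0)) * (y₀ + ∫ s in (0 : ℝ)..max t 0, F U s))
      (by
        have : Continuous fun t : ℝ => ∫ s in (0 : ℝ)..max t 0, F U s :=
          (hFc U).comp (by fun_prop : Continuous fun t : ℝ => max t 0)
        fun_prop)
      (|y₀| + ((rate + γ) * ‖U‖ + rate * (K + |lam|)) / L) (fun t => by
        have ht : 0 ≤ max t 0 := le_max_right t 0
        generalize max t 0 = t at ht
        have h1 := abs_integral_le_of_le_exp (L := L) (C := (rate + γ) * ‖U‖ + rate * (K + |lam|))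
          hL (by positivity) ht (h := F U) (fun s hs => by
            refine (abs_dynamics_le ν hK hrate hγ s _).trans ?_
            have h2 : 1 ≤ Real.exp (L * s) := Real.one_le_exp (mul_nonneg hL.le hs.1)
            have h3 : |U s| ≤ ‖U‖ := U.norm_coe_le_norm s
            rw [abs_mul, abs_of_pos (Real.exp_pos _),
              add_mul _ (rate * (K + |lam|)) (Real.exp (L * s))]
            refine add_le_add ?_ (le_mul_of_one_le_right (by positivity) h2)
            rw [mul_assoc (rate + γ) ‖U‖, mul_comm ‖U‖]
            gcongr)
        have h4 : Real.exp (-(L * t)) ≤ 1 := Real.exp_le_one_iff.2 (by nlinarith)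
        rw [Real.norm_eq_abs, abs_mul, abs_of_pos (Real.exp_pos _)]
        calc _ ≤ Real.exp (-(L * t)) * (|y₀| + |∫ s in (0 : ℝ)..t, F U s|) := by
              gcongr; exact abs_add_le _ _
          _ ≤ _ := by
              rw [mul_add]
              exact add_le_add (mul_le_of_le_one_left (abs_nonneg _) h4) h1)
  have hS : ContractingWith (1 / 2) S := by
    constructor
    · exact NNReal.half_lt_self one_ne_zero
    · refine LipschitzWith.of_dist_le_mul fun U₁ U₂ => ?_
      rw [BoundedContinuousFunction.dist_le (by positivity)]
      intro t
      change dist (Real.exp (-(L * max t 0)) * (y₀ + ∫ s in (0 : ℝ)..max t 0, F U₁ s))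
        (Real.exp (-(L * max t 0)) * (y₀ + ∫ s in (0 : ℝ)..max t 0, F U₂ s)) ≤ _
      have ht : 0 ≤ max t 0 := le_max_right t 0
      generalize max t 0 = t at ht
      rw [Real.dist_eq, ← mul_sub, add_sub_add_left_eq_sub,
        ← intervalIntegral.integral_sub (hF U₁ _ _) (hF U₂ _ _), abs_mul,
        abs_of_pos (Real.exp_pos _)]
      refine (abs_integral_le_of_le_exp (L := L) (C := (rate + γ) * dist U₁ U₂) hL (by positivity)
        ht (h := fun s => F U₁ s - F U₂ s) fun s hs => ?_).trans (le_of_eq ?_)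
      · refine (abs_dynamics_sub_le ν hrate hγ s _ _).trans ?_
        have h3 : |U₁ s - U₂ s| ≤ dist U₁ U₂ := by
          simpa [Real.dist_eq] using U₁.dist_coe_le_dist (g := U₂) s
        rw [← mul_sub, abs_mul, abs_of_pos (Real.exp_pos _), mul_assoc (rate + γ) (dist U₁ U₂),
          mul_comm (dist U₁ U₂)]
        gcongr
      · rw [hLdef]
        push_cast
        field_simp
  set U := hS.fixedPoint with hU
  have hfix : ∀ t, 0 ≤ t →
      Real.exp (L * t) * U t = y₀ + ∫ s in (0 : ℝ)..t, F U s := by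
    intro t ht
    have h1 : Real.exp (-(L * max t 0)) * (y₀ + ∫ s in (0 : ℝ)..max t 0, F U s) = U t :=
      DFunLike.congr_fun hS.fixedPoint_isFixedPt t
    rw [max_eq_left ht] at h1
    rw [← h1, ← mul_assoc, mul_comm (Real.exp (L * t)), hexp, one_mul]
  refine ⟨fun t => Real.exp (L * t) * U t, ?_, by fun_prop, fun t ht hc => ?_⟩
  · simpa using hfix 0 le_rfl
  have hc' := continuousAt_of_continuousWithinAt_Ici hext ht hc
  have hFcont : ContinuousAt (F U) t := by
    have h1 : ContinuousAt (fun s => k s + lam - Real.exp (L * s) * U s) t :=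
      (hc'.add continuousAt_const).sub (by fun_prop)
    have h2 := (continuous_truthfulProfit ν).continuousAt.comp h1
    exact ContinuousAt.sub (by fun_prop) (h2.const_mul rate)
  have h3 : HasDerivAt (fun u => ∫ s in (0 : ℝ)..u, F U s) (F U t) t :=
    intervalIntegral.integral_hasDerivAt_right (hF U 0 t)
      (measurable_dynamics ν hk.measurable
        (by fun_prop : Measurable fun s => Real.exp (L * s) * U s)
        ).stronglyMeasurable.stronglyMeasurableAtFilter
      hFcont
  exact ((h3.const_add y₀).hasDerivWithinAt).congr (fun s hs => hfix s hs) (hfix t ht)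

end Cauchy

/-! ### Solutions of F_v with a finite limit solve the Bellman equation -/

section BoundedSolution

variable {k : ℝ → ℝ} {K M rate γ v : ℝ} (ν : Measure ℝ)

theorem isSelfSolution_of_bellman (hk : Monotone k) (hK : ∀ t, |k t| ≤ K)
    (hext : ∀ t, k (max t 0) = k t) (hrate : 0 < rate) (hγ : 0 < γ) {W : ℝ → ℝ}
    (hWc : Continuous W) (hM : ∀ t, |W t| ≤ M)
    (hW : ∀ t, W t = rate * discountedFuture (rate + γ) (afterAuction k ν W) t) :
    IsSelfSolution k (fun x => cdf ν x) rate γ (W 0) W where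
  initial := rfl
  continuousOn := hWc.continuousOn
  hasDeriv t ht hc := by
    have hc' := continuousAt_of_continuousWithinAt_Ici hext ht hc
    have hG : ContinuousAt (afterAuction k ν W) t := by
      have h1 : ContinuousAt (fun s => k s + W 0 - W s) t :=
        (hc'.add continuousAt_const).sub hWc.continuousAt
      exact hWc.continuousAt.add ((continuous_truthfulProfit ν).continuousAt.comp h1)
    have h := (hasDerivAt_discountedFuture (by positivity : 0 < rate + γ)
      (measurable_afterAuction hk.measurable hWc.measurable)
      (fun r => abs_afterAuction_le (hK r) (hM r) (hM 0)) hG).const_mul rate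
    rw [← funext hW] at h
    refine (h.congr_deriv ?_).hasDerivWithinAt
    rw [mul_sub, mul_left_comm, ← hW t]
    unfold afterAuction dynamics
    ring

/-- The equation says that e^{-(rate+γ)r} Z r has derivative -rate e^{-(rate+γ)r} G_Z(r); integrate
over (t, ∞), the boundary term vanishing as Z is bounded. The parameter v must be Z 0 for G_Z to
appear. -/
theorem IsSelfSolution.eq_discountedFuture (hk : Monotone k) (hK : ∀ t, |k t| ≤ K)
    (hrate : 0 < rate) (hγ : 0 < γ) {Z : ℝ → ℝ} (hZc : Continuous Z) (hM : ∀ t, |Z t| ≤ M)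
    (hZ : IsSelfSolution k (fun x => cdf ν x) rate γ v Z) {t : ℝ} (ht : 0 ≤ t) :
    Z t = rate * discountedFuture (rate + γ) (afterAuction k ν Z) t := by
  have hβ : 0 < rate + γ := by positivity
  have hGm := measurable_afterAuction (ν := ν) hk.measurable hZc.measurable
  have hGb : ∀ r, |afterAuction k ν Z r| ≤ K + 3 * M :=
    fun r => abs_afterAuction_le (hK r) (hM r) (hM 0)
  have h1 : ∀ T, t ≤ T → ∫ r in t..T, Real.exp (-(rate + γ) * r) * afterAuction k ν Z r =
      (Real.exp (-(rate + γ) * t) * Z t - Real.exp (-(rate + γ) * T) * Z T) / rate := by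
    intro T hT
    have := integral_eq_of_hasDerivAt_off_countable_of_le
      (fun r => Real.exp (-(rate + γ) * r) * Z r)
      (fun r => -rate * (Real.exp (-(rate + γ) * r) * afterAuction k ν Z r)) hT
      hk.countable_not_continuousAt (by fun_prop) (fun s hs => ?_)
      ((intervalIntegrable_exp_neg_mul hβ hGm hGb _ _).const_mul _)
    · rw [intervalIntegral.integral_const_mul] at this
      rw [eq_div_iff hrate.ne']
      linarith
    · have h2 := IsSolution.hasDerivAt ν hZ (ht.trans_lt hs.1.1) (not_not.1 hs.2)
      have h3 : HasDerivAt (fun u => Real.exp (-(rate + γ) * u))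
          (Real.exp (-(rate + γ) * s) * -(rate + γ)) s := by
        simpa using ((hasDerivAt_id s).const_mul (-(rate + γ))).exp
      refine (h3.mul h2).congr_deriv ?_
      have h0 : Z 0 = v := hZ.initial
      unfold afterAuction dynamics
      rw [h0]
      ring
  have h2 : Tendsto (fun T => ∫ r in t..T, Real.exp (-(rate + γ) * r) * afterAuction k ν Z r)
      atTop (𝓝 (∫ r in Ioi t, Real.exp (-(rate + γ) * r) * afterAuction k ν Z r)) :=
    intervalIntegral_tendsto_integral_Ioi t (integrableOn_exp_neg_mul hβ hGm hGb t) tendsto_id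
  have h3 : Tendsto (fun T => Real.exp (-(rate + γ) * T) * Z T) atTop (𝓝 0) := by
    have h4 : Tendsto (fun T => Real.exp (-(rate + γ) * T)) atTop (𝓝 0) :=
      Real.tendsto_exp_atBot.comp (tendsto_id.const_mul_atTop_of_neg (by linarith))
    exact h4.zero_mul_isBoundedUnder_le (isBoundedUnder_of ⟨M, fun T => hM T⟩)
  have h5 : Tendsto (fun T => ∫ r in t..T, Real.exp (-(rate + γ) * r) * afterAuction k ν Z r)
      atTop (𝓝 ((Real.exp (-(rate + γ) * t) * Z t - 0) / rate)) :=
    ((tendsto_const_nhds.sub h3).div_const rate).congr'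
      ((eventually_ge_atTop t).mono fun T hT => (h1 T hT).symm)
  have h6 : Real.exp ((rate + γ) * t) * Real.exp (-(rate + γ) * t) = 1 := by
    rw [← Real.exp_add, neg_mul, add_neg_cancel, Real.exp_zero]
  rw [discountedFuture, tendsto_nhds_unique h2 h5, sub_zero, mul_div_assoc',
    mul_div_cancel₀ _ hrate.ne', ← mul_assoc, h6, one_mul]

/-- A solution of the self-parametrized problem with a finite limit is the solution of the dynamic
programming equation. -/
theorem IsSelfSolution.eqOn_bellman (hk : Monotone k) (hK : ∀ t, |k t| ≤ K)
    (hrate : 0 < rate) (hγ : 0 < γ) {W : ℝ → ℝ} (hWc : Continuous W) (hM : ∀ t, |W t| ≤ M)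
    (hW : ∀ t, W t = rate * discountedFuture (rate + γ) (afterAuction k ν W) t) {Z : ℝ → ℝ}
    (hZ : IsSelfSolution k (fun x => cdf ν x) rate γ v Z) {l : ℝ} (hl : Tendsto Z atTop (𝓝 l)) :
    EqOn Z W (Ici 0) := by
  wlog hc : Continuous Z ∧ ∃ M, ∀ t, |Z t| ≤ M generalizing Z
  · have hmax : Continuous fun t : ℝ => max t 0 := by fun_prop
    have e : EqOn (fun t => Z (max t 0)) Z (Ici 0) := fun t ht => by
      simp only [max_eq_left (mem_Ici.1 ht)]
    -- The limit bounds Z beyond some T, and compactness bounds it on [0, T].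
    have hb : ∃ M, ∀ t, |Z (max t 0)| ≤ M := by
      obtain ⟨T, hT⟩ := eventually_atTop.1 (hl.abs.eventually_le_const (lt_add_one |l|))
      obtain ⟨M, hM⟩ := (isCompact_Icc (a := (0 : ℝ)) (b := T)).exists_bound_of_continuousOn
        (hZ.continuousOn.mono Icc_subset_Ici_self)
      refine ⟨max (|l| + 1) M, fun t => ?_⟩
      rcases le_total T (max t 0) with h | h
      · exact (hT _ h).trans (le_max_left _ _)
      · exact (hM _ ⟨le_max_right t 0, h⟩).trans (le_max_right _ _)
    have := this (Z := fun t => Z (max t 0)) (IsSolution.congr_right hZ e)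
      (hl.congr' ((eventually_ge_atTop 0).mono fun t ht => (e ht).symm))
      ⟨hZ.continuousOn.comp_continuous hmax fun t => le_max_right t 0, hb⟩
    exact fun t ht => by rw [← e ht, this ht]
  obtain ⟨hZc, M', hM'⟩ := hc
  have hβ : 0 < rate + γ := by positivity
  have key := nonpos_of_forall_le_mul (f := fun t => |Z t - W t|) (s := Ici 0) (M := M' + M)
    (ρ := rate / (rate + γ)) (by positivity) (by rw [div_lt_one hβ]; linarith)
    (fun t _ => (abs_sub _ _).trans (add_le_add (hM' t) (hM t)))
    (fun B hB hle t ht => ?_)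
  · exact fun t ht => sub_eq_zero.1 (abs_nonpos_iff.1 (key t ht))
  rw [hW t, IsSelfSolution.eq_discountedFuture ν hk hK hrate hγ hZc hM' hZ ht, ← mul_sub, abs_mul,
    abs_of_pos hrate, div_mul_eq_mul_div, mul_div_assoc]
  refine mul_le_mul_of_nonneg_left ?_ hrate.le
  exact abs_discountedFuture_sub_le hβ (measurable_afterAuction hk.measurable hZc.measurable)
    (fun r => abs_afterAuction_le (hK r) (hM' r) (hM' 0))
    (measurable_afterAuction hk.measurable hWc.measurable)
    (fun r => abs_afterAuction_le (hK r) (hM r) (hM 0)) fun r hr =>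
      abs_afterAuction_sub_le (hle r (mem_Ici.2 (le_trans ht hr.le))) (hle 0 (mem_Ici.2 le_rfl))

end BoundedSolution

/-! ### Splitting off the first auction -/

section FirstAuction

/-- The sample whose first auction is `x` and whose later auctions are those of `ω`. -/
def prepend (x : ℝ × ℝ) (ω : Sample) : Sample
  | 0 => x
  | i + 1 => ω i

@[simp]
theorem prepend_zero (x : ℝ × ℝ) (ω : Sample) : prepend x ω 0 = x := rfl

@[simp]
theorem prepend_succ (x : ℝ × ℝ) (ω : Sample) (i : ℕ) : prepend x ω (i + 1) = ω i := rfl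

theorem measurable_prepend : Measurable fun p : (ℝ × ℝ) × Sample => prepend p.1 p.2 := by
  refine measurable_pi_lambda _ fun i => ?_
  cases i with
  | zero => exact measurable_fst
  | succ i => exact (measurable_pi_apply i).comp measurable_snd

/-- An i.i.d. sequence is an independent first term followed by a copy of itself; it suffices to
check this on finite boxes. -/
theorem map_prepend (P : Measure (ℝ × ℝ)) [IsProbabilityMeasure P] :
    (P.prod (Measure.infinitePi fun _ : ℕ => P)).map (fun p => prepend p.1 p.2) =
      Measure.infinitePi fun _ : ℕ => P := by
  classical
  refine Measure.eq_infinitePi (fun _ : ℕ => P) fun s t ht => ?_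
  obtain ⟨N, hN⟩ : ∃ N, s ⊆ Finset.range (N + 1) :=
    ⟨s.sup id, fun i hi => Finset.mem_range.2 (Nat.lt_succ_of_le (Finset.le_sup (f := id) hi))⟩
  -- Padding with `univ` makes the box a product over all indices 0, …, N.
  let t' : ℕ → Set (ℝ × ℝ) := fun i => if i ∈ s then t i else univ
  have ht' : ∀ i, MeasurableSet (t' i) := fun i => by
    by_cases hi : i ∈ s <;> simp [t', hi, ht i]
  have hpre : (fun p : (ℝ × ℝ) × Sample => prepend p.1 p.2) ⁻¹' (Set.pi s t) =
      t' 0 ×ˢ Set.pi (Finset.range N : Set ℕ) fun i => t' (i + 1) := by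
    ext ⟨x, ω⟩
    simp only [mem_preimage, Set.mem_pi, Finset.mem_coe, mem_prod, Finset.mem_range]
    constructor
    · intro h
      refine ⟨?_, fun i _ => ?_⟩
      · by_cases h0 : 0 ∈ s
        · simpa [t', h0] using h 0 h0
        · simp [t', h0]
      · by_cases h0 : i + 1 ∈ s
        · simpa [t', h0] using h (i + 1) h0
        · simp [t', h0]
    · rintro ⟨h0, h1⟩ i hi
      cases i with
      | zero => simpa [t', hi] using h0
      | succ i =>
        have := h1 i (by have := Finset.mem_range.1 (hN hi); omega)
        simpa [t', hi] using this
  rw [Measure.map_apply measurable_prepend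
    (MeasurableSet.pi s.countable_toSet fun i _ => ht i), hpre, Measure.prod_prod,
    Measure.infinitePi_pi _ fun i _ => ht' (i + 1), mul_comm,
    ← Finset.prod_range_succ' (fun i => P (t' i)), ← Finset.prod_subset hN]
  · exact Finset.prod_congr rfl fun i hi => by simp [t', hi]
  · intro i _ hi
    simp [t', hi]

theorem lintegral_auctionLaw {rate : ℝ} (hrate : 0 < rate) (ν : Measure ℝ) [IsProbabilityMeasure ν]
    {f : Sample → ENNReal} (hf : Measurable f) :
    ∫⁻ ω, f ω ∂(auctionLaw rate ν) =
      ∫⁻ x, ∫⁻ ω, f (prepend x ω) ∂(auctionLaw rate ν) ∂((expMeasure rate).prod ν) := by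
  have := isProbabilityMeasure_expMeasure hrate
  unfold auctionLaw
  conv_lhs => rw [← map_prepend ((expMeasure rate).prod ν)]
  rw [lintegral_map hf measurable_prepend]
  exact lintegral_prod _ (hf.comp measurable_prepend).aemeasurable

end FirstAuction

/-! ### Recursion for expected gains and losses -/

section Recursion

variable (k : ℝ → ℝ) (γ : ℝ) (b : ℝ → ℝ)

open Classical in
/-- Age right after an auction, when `x` is the waiting time and the price to beat. -/
def nextAge (τ : ℝ) (x : ℝ × ℝ) : ℝ := if x.2 < b (τ + x.1) then 0 else τ + x.1

open Classical in
/-- Undiscounted profit at the first auction, when `x` is the waiting time and the price to beat. -/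
def firstProfit (τ : ℝ) (x : ℝ × ℝ) : ℝ := if x.2 < b (τ + x.1) then k (τ + x.1) - x.2 else 0

theorem age_prepend_succ (τ : ℝ) (x : ℝ × ℝ) (ω : Sample) (i : ℕ) :
    age b τ (prepend x ω) (i + 1) = age b (nextAge b τ x) ω i := by
  induction i with
  | zero => rfl
  | succ i ih =>
    rw [age, ih]
    rfl

theorem auctionTime_prepend_succ (x : ℝ × ℝ) (ω : Sample) (i : ℕ) :
    auctionTime (prepend x ω) (i + 1) = x.1 + auctionTime ω i := by
  rw [auctionTime, Finset.sum_range_succ', add_comm]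
  rfl

theorem profit_prepend_zero (τ : ℝ) (x : ℝ × ℝ) (ω : Sample) :
    profit k γ b τ (prepend x ω) 0 = Real.exp (-γ * x.1) * firstProfit k b τ x := by
  have h : auctionTime (prepend x ω) 0 = x.1 := by simp [auctionTime, waiting, prepend]
  rw [profit, h, firstProfit, mul_ite, mul_zero]
  rfl

theorem profit_prepend_succ (τ : ℝ) (x : ℝ × ℝ) (ω : Sample) (i : ℕ) :
    profit k γ b τ (prepend x ω) (i + 1) =
      Real.exp (-γ * x.1) * profit k γ b (nextAge b τ x) ω i := by
  have h : price (prepend x ω) (i + 1) = price ω i := rfl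
  rw [profit, profit, age_prepend_succ, auctionTime_prepend_succ, h, mul_ite, mul_zero, mul_add,
    Real.exp_add, mul_assoc]

variable {k b}

theorem measurable_waiting (i : ℕ) : Measurable fun ω : Sample => waiting ω i :=
  measurable_fst.comp (measurable_pi_apply i)

theorem measurable_price (i : ℕ) : Measurable fun ω : Sample => price ω i :=
  measurable_snd.comp (measurable_pi_apply i)

theorem measurable_auctionTime (i : ℕ) : Measurable fun ω : Sample => auctionTime ω i :=
  Finset.measurable_sum _ fun j _ => measurable_waiting j

theorem measurable_age (hb : Measurable b) (i : ℕ) :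
    Measurable fun p : ℝ × Sample => age b p.1 p.2 i := by
  have hw : ∀ i, Measurable fun p : ℝ × Sample => waiting p.2 i :=
    fun i => (measurable_waiting i).comp measurable_snd
  induction i with
  | zero => exact measurable_fst.add (hw 0)
  | succ i ih =>
    exact (Measurable.ite (measurableSet_lt ((measurable_price i).comp measurable_snd)
      (hb.comp ih)) measurable_const ih).add (hw (i + 1))

theorem measurable_profit (hk : Measurable k) (hb : Measurable b) (i : ℕ) :
    Measurable fun p : ℝ × Sample => profit k γ b p.1 p.2 i := by
  have ha := measurable_age hb i
  have hc : Measurable fun p : ℝ × Sample => price p.2 i :=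
    (measurable_price i).comp measurable_snd
  have ht : Measurable fun p : ℝ × Sample => auctionTime p.2 i :=
    (measurable_auctionTime i).comp measurable_snd
  exact Measurable.ite (measurableSet_lt hc (hb.comp ha))
    ((Real.measurable_exp.comp (ht.const_mul (-γ))).mul ((hk.comp ha).sub hc)) measurable_const

theorem measurable_nextAge (hb : Measurable b) :
    Measurable fun p : ℝ × (ℝ × ℝ) => nextAge b p.1 p.2 := by
  have ha : Measurable fun p : ℝ × (ℝ × ℝ) => p.1 + p.2.1 := by fun_prop
  exact Measurable.ite (measurableSet_lt (by fun_prop) (hb.comp ha)) measurable_const ha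

theorem measurable_firstProfit (hk : Measurable k) (hb : Measurable b) :
    Measurable fun p : ℝ × (ℝ × ℝ) => firstProfit k b p.1 p.2 := by
  have ha : Measurable fun p : ℝ × (ℝ × ℝ) => p.1 + p.2.1 := by fun_prop
  exact Measurable.ite (measurableSet_lt (by fun_prop) (hb.comp ha))
    ((hk.comp ha).sub (by fun_prop)) measurable_const

variable (k b) in
/-- Expected discounted total gain (`σ = 1`) or loss (`σ = -1`) over the first `n` auctions. -/
def expectedPart (rate : ℝ) (ν : Measure ℝ) (σ : ℝ) (n : ℕ) (τ : ℝ) : ENNReal :=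
  ∫⁻ ω, ∑ i ∈ Finset.range n, ENNReal.ofReal (σ * profit k γ b τ ω i) ∂(auctionLaw rate ν)

variable {rate : ℝ} (ν : Measure ℝ)

theorem measurable_ofReal_profit (hk : Measurable k) (hb : Measurable b) (σ τ : ℝ) (i : ℕ) :
    Measurable fun ω : Sample => ENNReal.ofReal (σ * profit k γ b τ ω i) :=
  (((measurable_profit γ hk hb i).comp (measurable_prodMk_left (x := τ))).const_mul σ).ennreal_ofReal

theorem expectedPart_zero (σ τ : ℝ) : expectedPart k γ b rate ν σ 0 τ = 0 := by
  simp [expectedPart]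

theorem lintegral_tsum_profit (hk : Measurable k) (hb : Measurable b) (σ τ : ℝ) :
    ∫⁻ ω, ∑' i, ENNReal.ofReal (σ * profit k γ b τ ω i) ∂(auctionLaw rate ν) =
      ⨆ n, expectedPart k γ b rate ν σ n τ := by
  simp_rw [ENNReal.tsum_eq_iSup_nat, expectedPart]
  refine lintegral_iSup
    (fun n => Finset.measurable_sum _ fun i _ => measurable_ofReal_profit γ hk hb σ τ i) ?_
  intro m n hmn ω
  exact Finset.sum_le_sum_of_subset (Finset.range_mono hmn)

theorem value_eq (hk : Measurable k) (hb : Measurable b) (τ : ℝ) :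
    value k ν rate γ b τ = ((⨆ n, expectedPart k γ b rate ν 1 n τ : ENNReal) : EReal) -
      ((⨆ n, expectedPart k γ b rate ν (-1) n τ : ENNReal) : EReal) := by
  rw [← lintegral_tsum_profit γ ν hk hb, ← lintegral_tsum_profit γ ν hk hb]
  simp only [value, one_mul, neg_one_mul]

variable [IsProbabilityMeasure ν]

theorem isProbabilityMeasure_auctionLaw (hrate : 0 < rate) :
    IsProbabilityMeasure (auctionLaw rate ν) := by
  have := isProbabilityMeasure_expMeasure hrate
  unfold auctionLaw
  infer_instance

theorem measurable_expectedPart (hrate : 0 < rate) (hk : Measurable k) (hb : Measurable b)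
    (σ : ℝ) (n : ℕ) : Measurable (expectedPart k γ b rate ν σ n) := by
  have := isProbabilityMeasure_auctionLaw ν hrate
  refine Measurable.lintegral_prod_right' (f := fun p : ℝ × Sample =>
    ∑ i ∈ Finset.range n, ENNReal.ofReal (σ * profit k γ b p.1 p.2 i)) ?_
  exact Finset.measurable_sum _ fun i _ => ((measurable_profit γ hk hb i).const_mul σ).ennreal_ofReal

/-- Renewal at the first auction: the later auctions form a fresh sample started from `nextAge`,
discounted by e^{-γ x.1}. -/
theorem expectedPart_succ (hrate : 0 < rate) (hk : Measurable k) (hb : Measurable b)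
    (σ : ℝ) (n : ℕ) (τ : ℝ) :
    expectedPart k γ b rate ν σ (n + 1) τ = ∫⁻ x, ENNReal.ofReal (Real.exp (-γ * x.1)) *
      (ENNReal.ofReal (σ * firstProfit k b τ x) + expectedPart k γ b rate ν σ n (nextAge b τ x))
      ∂((expMeasure rate).prod ν) := by
  have := isProbabilityMeasure_auctionLaw ν hrate
  rw [expectedPart, lintegral_auctionLaw hrate ν
    (Finset.measurable_sum _ fun i _ => measurable_ofReal_profit γ hk hb σ τ i)]
  refine lintegral_congr fun x => ?_
  have h : ∀ y : ℝ, ENNReal.ofReal (σ * (Real.exp (-γ * x.1) * y)) =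
      ENNReal.ofReal (Real.exp (-γ * x.1)) * ENNReal.ofReal (σ * y) := fun y => by
    rw [mul_left_comm, ENNReal.ofReal_mul (Real.exp_pos _).le]
  simp_rw [Finset.sum_range_succ', profit_prepend_zero, profit_prepend_succ, h]
  rw [lintegral_add_right _ measurable_const, lintegral_const, measure_univ, mul_one, mul_add,
    add_comm]
  congr 1
  simp_rw [← Finset.mul_sum]
  rw [lintegral_const_mul _
    (Finset.measurable_sum _ fun i _ => measurable_ofReal_profit γ hk hb σ _ i)]
  rfl

end Recursion

/-! ### Ages are almost surely nonnegative -/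

section Nonnegative

variable {rate : ℝ} (ν : Measure ℝ) [IsProbabilityMeasure ν]

theorem ae_expMeasure_nonneg (r : ℝ) : ∀ᵐ w ∂(expMeasure r), 0 ≤ w := by
  have h : expMeasure r (Iio 0) = 0 := by
    rw [expMeasure, gammaMeasure, withDensity_apply _ measurableSet_Iio]
    exact lintegral_gammaPDF_of_nonpos le_rfl
  rw [ae_iff]
  simpa [Iio] using h

theorem ae_waiting_nonneg (hrate : 0 < rate) :
    ∀ᵐ ω ∂(auctionLaw rate ν), ∀ i, 0 ≤ waiting ω i := by
  have := isProbabilityMeasure_expMeasure hrate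
  refine ae_all_iff.2 fun i => ?_
  have h1 := Measure.quasiMeasurePreserving_fst (μ := expMeasure rate) (ν := ν)
  have h2 := (measurePreserving_eval_infinitePi
    (fun _ : ℕ => (expMeasure rate).prod ν) i).quasiMeasurePreserving
  exact h2.ae (h1.ae (ae_expMeasure_nonneg rate))

theorem age_nonneg {b : ℝ → ℝ} {τ : ℝ} {ω : Sample} (hτ : 0 ≤ τ) (hω : ∀ i, 0 ≤ waiting ω i)
    (i : ℕ) : 0 ≤ age b τ ω i := by
  induction i with
  | zero => exact add_nonneg hτ (hω 0)
  | succ i ih =>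
    refine add_nonneg ?_ (hω (i + 1))
    split_ifs
    exacts [le_rfl, ih]

theorem value_congr (hrate : 0 < rate) {k k' : ℝ → ℝ} (hk : EqOn k k' (Ici 0)) (γ : ℝ)
    (b : ℝ → ℝ) {τ : ℝ} (hτ : 0 ≤ τ) : value k ν rate γ b τ = value k' ν rate γ b τ := by
  have h : ∀ᵐ ω ∂(auctionLaw rate ν), ∀ i, profit k γ b τ ω i = profit k' γ b τ ω i := by
    filter_upwards [ae_waiting_nonneg ν hrate] with ω hω i
    rw [profit, profit, hk (age_nonneg hτ hω i)]
  unfold value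
  congr 2
  · exact lintegral_congr_ae (h.mono fun ω hω => by simp only [hω])
  · exact lintegral_congr_ae (h.mono fun ω hω => by simp only [hω])

end Nonnegative

/-! ### The Bellman equation as an expectation -/

section Bellman

variable {k : ℝ → ℝ} {K M rate γ : ℝ} {ν : Measure ℝ}

/-- The exponential density and the discount combine into rate e^{-(rate+γ)w}. -/
theorem lintegral_expMeasure_mul {g : ℝ → ℝ} (hrate : 0 < rate) (hγ : 0 < γ) (hg : Measurable g)
    (hg₀ : ∀ t, 0 ≤ g t) (hM : ∀ t, |g t| ≤ M) (τ : ℝ) :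
    ∫⁻ w, ENNReal.ofReal (Real.exp (-γ * w)) * ENNReal.ofReal (g (τ + w)) ∂(expMeasure rate) =
      ENNReal.ofReal (rate * discountedFuture (rate + γ) g τ) := by
  have hβ : 0 < rate + γ := by positivity
  have hgs : Measurable fun w => g (τ + w) := by fun_prop
  have hi := integrableOn_exp_neg_mul hβ hgs (fun r => hM (τ + r)) 0
  have h1 : rate * discountedFuture (rate + γ) g τ =
      ∫ w in Ioi 0, rate * (Real.exp (-(rate + γ) * w) * g (τ + w)) := by
    rw [integral_const_mul]
    have := discountedFuture_comp_add (β := rate + γ) (g := g) τ 0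
    rw [zero_add] at this
    rw [← this, discountedFuture]
    simp [add_comm τ]
  rw [h1, ofReal_integral_eq_lintegral_ofReal (hi.const_mul rate)
    (ae_of_all _ fun w => mul_nonneg hrate.le (mul_nonneg (Real.exp_pos _).le (hg₀ _))),
    expMeasure, gammaMeasure, lintegral_withDensity_eq_lintegral_mul _
      (f := gammaPDF 1 rate) (measurable_gammaPDFReal 1 rate).ennreal_ofReal (by fun_prop),
    ← setLIntegral_congr Ioi_ae_eq_Ici.symm, ← lintegral_indicator measurableSet_Ici]
  refine lintegral_congr fun w => ?_
  change exponentialPDF rate w *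
    (ENNReal.ofReal (Real.exp (-γ * w)) * ENNReal.ofReal (g (τ + w))) = _
  rw [exponentialPDF_eq]
  by_cases hw : 0 ≤ w
  · rw [if_pos hw, indicator_of_mem (mem_Ici.2 hw), ← ENNReal.ofReal_mul (Real.exp_pos _).le,
      ← ENNReal.ofReal_mul (by positivity)]
    congr 1
    have : Real.exp (-(rate + γ) * w) = Real.exp (-(rate * w)) * Real.exp (-γ * w) := by
      rw [← Real.exp_add]; ring_nf
    rw [this]
    ring
  · rw [if_neg hw, indicator_of_notMem (by simpa using hw), ENNReal.ofReal_zero, zero_mul]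

variable [IsProbabilityMeasure ν]

theorem lintegral_prod_discount (hrate : 0 < rate) (hγ : 0 < γ) :
    ∫⁻ x : ℝ × ℝ, ENNReal.ofReal (Real.exp (-γ * x.1)) ∂((expMeasure rate).prod ν) =
      ENNReal.ofReal (rate / (rate + γ)) := by
  have h := lintegral_expMeasure_mul (g := fun _ => 1) (M := 1) hrate hγ measurable_const
    (by simp) (by simp) 0
  have h1 := integral_exp_neg_Ioi (by positivity : 0 < rate + γ) 0
  simp only [discountedFuture, mul_one, h1, ENNReal.ofReal_one, mul_one_div] at h
  rw [lintegral_prod _ (by fun_prop)]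
  simpa using h

/-- The dynamic programming equation as an expectation over the first auction. -/
theorem ofReal_bellman (hν : ν (Iio 0) = 0) (hk : Measurable k) (hK : ∀ t, |k t| ≤ K)
    (hrate : 0 < rate) (hγ : 0 < γ) {W : ℝ → ℝ} (hWm : Measurable W) (hW₀ : ∀ t, 0 ≤ W t)
    (hM : ∀ t, |W t| ≤ M)
    (hW : ∀ t, W t = rate * discountedFuture (rate + γ) (afterAuction k ν W) t) (τ : ℝ) :
    ∫⁻ x : ℝ × ℝ, ENNReal.ofReal (Real.exp (-γ * x.1)) *
      ENNReal.ofReal (max (W (τ + x.1)) (k (τ + x.1) - x.2 + W 0)) ∂((expMeasure rate).prod ν) =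
      ENNReal.ofReal (W τ) := by
  rw [lintegral_prod _ (by fun_prop), hW τ, ← lintegral_expMeasure_mul hrate hγ
    (measurable_afterAuction hk hWm)
    (fun t => add_nonneg (hW₀ t) (truthfulProfit_nonneg ν hν _))
    (fun r => abs_afterAuction_le (hK r) (hM r) (hM 0))]
  refine lintegral_congr fun w => ?_
  dsimp only
  rw [lintegral_const_mul _ (by fun_prop)]
  congr 1
  -- The maximum is W plus the positive part of (k + W 0 - W) - c, whose mean is π(k + W 0 - W).
  have h : ∀ c : ℝ, ENNReal.ofReal (max (W (τ + w)) (k (τ + w) - c + W 0)) =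
      ENNReal.ofReal (W (τ + w)) + ENNReal.ofReal (k (τ + w) + W 0 - W (τ + w) - c) := by
    intro c
    rcases le_total (k (τ + w) + W 0 - W (τ + w) - c) 0 with h | h
    · rw [ENNReal.ofReal_of_nonpos h, add_zero, max_eq_left (by linarith)]
    · rw [← ENNReal.ofReal_add (hW₀ _) h, max_eq_right (by linarith)]
      congr 1; ring
  simp_rw [h]
  rw [lintegral_add_left measurable_const, lintegral_const, measure_univ, mul_one,
    lintegral_ofReal_sub ν hν, ← ENNReal.ofReal_add (hW₀ _) (truthfulProfit_nonneg ν hν _)]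
  rfl

end Bellman

/-! ### Verification: the fixed point is the optimal value -/

section Verification

variable {k b W : ℝ → ℝ} {K M rate γ : ℝ} {ν : Measure ℝ}

/-- Winning or losing, profit plus continuation is one of the two terms of the maximum. The negative
part of the profit sits on the right to avoid subtraction in `ENNReal`. -/
theorem ofReal_firstProfit_add_le (hW₀ : ∀ t, 0 ≤ W t) (τ : ℝ) (x : ℝ × ℝ) :
    ENNReal.ofReal (1 * firstProfit k b τ x) + ENNReal.ofReal (W (nextAge b τ x)) ≤
      ENNReal.ofReal (-1 * firstProfit k b τ x) +
        ENNReal.ofReal (max (W (τ + x.1)) (k (τ + x.1) - x.2 + W 0)) := by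
  rw [one_mul, neg_one_mul]
  unfold firstProfit nextAge
  split_ifs
  · rcases le_total 0 (k (τ + x.1) - x.2) with h | h
    · rw [← ENNReal.ofReal_add h (hW₀ 0)]
      exact le_add_left (ENNReal.ofReal_le_ofReal (le_max_right _ _))
    · rw [ENNReal.ofReal_of_nonpos h, zero_add, ← ENNReal.ofReal_add (by linarith)
        (le_max_of_le_left (hW₀ _))]
      refine ENNReal.ofReal_le_ofReal ?_
      linarith [le_max_right (W (τ + x.1)) (k (τ + x.1) - x.2 + W 0)]
  · simp only [neg_zero, ENNReal.ofReal_zero, zero_add]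
    exact ENNReal.ofReal_le_ofReal (le_max_left _ _)

variable (k W) in
/-- The optimal bid `(k + W(0) - W)⁺`. -/
def optimalBid (a : ℝ) : ℝ := max 0 (k a + W 0 - W a)

theorem isPolicy_optimalBid (hk : Measurable k) (hWm : Measurable W) :
    IsPolicy (optimalBid k W) :=
  ⟨measurable_const.max ((hk.add_const _).sub hWm), fun _ => le_max_left _ _⟩

/-- This bid wins exactly when winning is the strictly better option. Truncating it at 0 is harmless
because prices are nonnegative. -/
theorem ofReal_max_add_firstProfit_le (hW₀ : ∀ t, 0 ≤ W t) (τ : ℝ) {x : ℝ × ℝ} (hx : 0 ≤ x.2) :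
    ENNReal.ofReal (max (W (τ + x.1)) (k (τ + x.1) - x.2 + W 0)) +
        ENNReal.ofReal (-1 * firstProfit k (optimalBid k W) τ x) ≤
      ENNReal.ofReal (1 * firstProfit k (optimalBid k W) τ x) +
        ENNReal.ofReal (W (nextAge (optimalBid k W) τ x)) := by
  rw [one_mul, neg_one_mul]
  unfold firstProfit nextAge
  split_ifs with hwin
  · have hlt : x.2 < k (τ + x.1) + W 0 - W (τ + x.1) :=
      (lt_max_iff.1 hwin).resolve_left (not_lt.2 hx)
    have := hW₀ (τ + x.1)
    rw [max_eq_right (by linarith)]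
    rcases le_total 0 (k (τ + x.1) - x.2) with h | h
    · rw [← ENNReal.ofReal_add h (hW₀ 0), ENNReal.ofReal_of_nonpos (by linarith : -_ ≤ (0 : ℝ)),
        add_zero]
    · rw [ENNReal.ofReal_of_nonpos h, zero_add, ← ENNReal.ofReal_add (by linarith) (by linarith)]
      exact ENNReal.ofReal_le_ofReal (by linarith)
  · have hle : k (τ + x.1) + W 0 - W (τ + x.1) ≤ x.2 :=
      (le_max_right _ _).trans (not_lt.1 hwin)
    rw [max_eq_left (by linarith)]
    simp

theorem ae_prod_price_nonneg [IsProbabilityMeasure ν] (hν : ν (Iio 0) = 0) (hrate : 0 < rate) :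
    ∀ᵐ x ∂((expMeasure rate).prod ν), 0 ≤ x.2 := by
  have := isProbabilityMeasure_expMeasure hrate
  exact Measure.quasiMeasurePreserving_snd.ae (ae_price_nonneg ν hν)

variable [IsProbabilityMeasure ν]

theorem expectedPart_gain_le (hk : Measurable k) (hb : Measurable b)
    (hrate : 0 < rate) (hWm : Measurable W) (hW₀ : ∀ t, 0 ≤ W t)
    (hbell : ∀ τ, ∫⁻ x : ℝ × ℝ, ENNReal.ofReal (Real.exp (-γ * x.1)) *
      ENNReal.ofReal (max (W (τ + x.1)) (k (τ + x.1) - x.2 + W 0)) ∂((expMeasure rate).prod ν) =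
      ENNReal.ofReal (W τ)) (n : ℕ) (τ : ℝ) :
    expectedPart k γ b rate ν 1 n τ ≤
      expectedPart k γ b rate ν (-1) n τ + ENNReal.ofReal (W τ) := by
  induction n generalizing τ with
  | zero => simp [expectedPart_zero]
  | succ n ih =>
    rw [expectedPart_succ γ ν hrate hk hb, expectedPart_succ γ ν hrate hk hb, ← hbell τ,
      ← lintegral_add_right _ (by fun_prop)]
    refine lintegral_mono fun x => ?_
    beta_reduce
    rw [← mul_add]
    refine mul_le_mul_right ?_ _
    calc _ ≤ ENNReal.ofReal (1 * firstProfit k b τ x) +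
          (expectedPart k γ b rate ν (-1) n (nextAge b τ x)
            + ENNReal.ofReal (W (nextAge b τ x))) := by gcongr; exact ih _
      _ = (ENNReal.ofReal (1 * firstProfit k b τ x) + ENNReal.ofReal (W (nextAge b τ x))) +
          expectedPart k γ b rate ν (-1) n (nextAge b τ x) := by ring
      _ ≤ _ := add_le_add_left (ofReal_firstProfit_add_le hW₀ τ x) _
      _ = _ := add_right_comm _ _ _

theorem measurable_discounted_part (hk : Measurable k) (hb : Measurable b) (hrate : 0 < rate)
    (σ : ℝ) (n : ℕ) (τ : ℝ) :
    Measurable fun x : ℝ × ℝ => ENNReal.ofReal (Real.exp (-γ * x.1)) *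
      (ENNReal.ofReal (σ * firstProfit k b τ x)
        + expectedPart k γ b rate ν σ n (nextAge b τ x)) := by
  have h1 : Measurable fun x : ℝ × ℝ => firstProfit k b τ x :=
    (measurable_firstProfit hk hb).comp (measurable_prodMk_left (x := τ))
  have h2 : Measurable fun x : ℝ × ℝ => nextAge b τ x :=
    (measurable_nextAge hb).comp (measurable_prodMk_left (x := τ))
  have h3 := (measurable_expectedPart γ ν hrate hk hb σ n).comp h2
  exact Measurable.mul (by fun_prop) ((h1.const_mul σ).ennreal_ofReal.add h3)

/-- The error is what may still be earned after n auctions: at most M, discounted by E e^{-γ T_n} =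
ρⁿ. -/
theorem expectedPart_optimal_ge (hν : ν (Iio 0) = 0) (hk : Measurable k)
    (hrate : 0 < rate) (hγ : 0 < γ) (hWm : Measurable W) (hW₀ : ∀ t, 0 ≤ W t)
    (hM : ∀ t, W t ≤ M)
    (hbell : ∀ τ, ∫⁻ x : ℝ × ℝ, ENNReal.ofReal (Real.exp (-γ * x.1)) *
      ENNReal.ofReal (max (W (τ + x.1)) (k (τ + x.1) - x.2 + W 0)) ∂((expMeasure rate).prod ν) =
      ENNReal.ofReal (W τ)) (n : ℕ) (τ : ℝ) :
    ENNReal.ofReal (W τ) + expectedPart k γ (optimalBid k W) rate ν (-1) n τ ≤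
      expectedPart k γ (optimalBid k W) rate ν 1 n τ +
        ENNReal.ofReal (rate / (rate + γ)) ^ n * ENNReal.ofReal M := by
  have hb := (isPolicy_optimalBid hk hWm).1
  induction n generalizing τ with
  | zero => simpa [expectedPart_zero] using ENNReal.ofReal_le_ofReal (hM τ)
  | succ n ih =>
    rw [expectedPart_succ γ ν hrate hk hb, expectedPart_succ γ ν hrate hk hb, ← hbell τ,
      ← lintegral_add_left (by fun_prop), pow_succ', mul_assoc,
      ← lintegral_prod_discount (ν := ν) hrate hγ, ← lintegral_mul_const _ (by fun_prop),
      ← lintegral_add_left (measurable_discounted_part hk hb hrate 1 n τ)]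
    refine lintegral_mono_ae ?_
    filter_upwards [ae_prod_price_nonneg hν hrate] with x hx
    rw [← mul_add, ← mul_add]
    refine mul_le_mul_right ?_ _
    rw [← add_assoc]
    refine (add_le_add_left (ofReal_max_add_firstProfit_le hW₀ τ hx) _).trans ?_
    rw [add_assoc, add_assoc]
    refine add_le_add_right ?_ _
    -- Undoes the rewriting of ρ as an expectation inside the remaining power ρⁿ.
    rw [lintegral_prod_discount (ν := ν) hrate hγ]
    exact ih _

/-- Prices being nonnegative, an auction yields at most K, and K(ρ + ρ² + …) = K rate/γ. Finiteness
of the gain makes gain minus loss meaningful. -/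
theorem expectedPart_gain_le_const (hν : ν (Iio 0) = 0) (hk : Measurable k) (hb : Measurable b)
    (hK : ∀ t, |k t| ≤ K) (hrate : 0 < rate) (hγ : 0 < γ) (n : ℕ) (τ : ℝ) :
    expectedPart k γ b rate ν 1 n τ ≤ ENNReal.ofReal (K * rate / γ) := by
  have hK₀ : 0 ≤ K := (abs_nonneg _).trans (hK 0)
  induction n generalizing τ with
  | zero => simp [expectedPart_zero]
  | succ n ih =>
    have e : ENNReal.ofReal (K * rate / γ) = ∫⁻ x : ℝ × ℝ, ENNReal.ofReal (Real.exp (-γ * x.1)) *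
        (ENNReal.ofReal K + ENNReal.ofReal (K * rate / γ)) ∂((expMeasure rate).prod ν) := by
      rw [lintegral_mul_const _ (by fun_prop), lintegral_prod_discount hrate hγ,
        ← ENNReal.ofReal_add hK₀ (by positivity), ← ENNReal.ofReal_mul (by positivity)]
      congr 1
      field_simp
      ring
    rw [expectedPart_succ γ ν hrate hk hb, e]
    refine lintegral_mono_ae ?_
    filter_upwards [ae_prod_price_nonneg hν hrate] with x hx
    refine mul_le_mul_right (add_le_add (ENNReal.ofReal_le_ofReal ?_) (ih _)) _
    rw [one_mul, firstProfit]
    split_ifs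
    · linarith [(abs_le.1 (hK (τ + x.1))).2]
    · exact hK₀

theorem optimalValue_eq (hν : ν (Iio 0) = 0) (hk : Measurable k) (hK : ∀ t, |k t| ≤ K)
    (hrate : 0 < rate) (hγ : 0 < γ) (hWm : Measurable W) (hW₀ : ∀ t, 0 ≤ W t)
    (hM : ∀ t, |W t| ≤ M)
    (hW : ∀ t, W t = rate * discountedFuture (rate + γ) (afterAuction k ν W) t) (τ : ℝ) :
    optimalValue k ν rate γ τ = (W τ : EReal) := by
  have hbell := ofReal_bellman hν hk hK hrate hγ hWm hW₀ hM hW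
  have hWE : ((ENNReal.ofReal (W τ) : ENNReal) : EReal) = (W τ : EReal) := by
    rw [EReal.coe_ennreal_ofReal, max_eq_left (hW₀ τ)]
  refine le_antisymm (iSup₂_le fun b hb => ?_) (le_iSup₂_of_le (optimalBid k W)
    (isPolicy_optimalBid hk hWm) ?_)
  · rw [value_eq γ ν hk hb.1]
    refine EReal.sub_le_of_le_add ?_
    rw [← hWE, ← EReal.coe_ennreal_add, EReal.coe_ennreal_le_coe_ennreal_iff, add_comm]
    refine iSup_le fun n => (expectedPart_gain_le hk hb.1 hrate hWm hW₀ hbell n τ).trans ?_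
    gcongr
    exact le_iSup (fun n => expectedPart k γ b rate ν (-1) n τ) n
  · have hb := (isPolicy_optimalBid hk hWm).1
    rw [value_eq γ ν hk hb]
    set P := ⨆ n, expectedPart k γ (optimalBid k W) rate ν 1 n τ with hP
    set N := ⨆ n, expectedPart k γ (optimalBid k W) rate ν (-1) n τ with hN
    have hPtop : P ≠ ⊤ := ne_top_of_le_ne_top ENNReal.ofReal_ne_top
      (iSup_le fun n => expectedPart_gain_le_const hν hk hb hK hrate hγ n τ)
    have hle : ENNReal.ofReal (W τ) + N ≤ P := by
      have hmono : Monotone fun n => expectedPart k γ (optimalBid k W) rate ν (-1) n τ :=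
        fun m n hmn => lintegral_mono fun ω =>
          Finset.sum_le_sum_of_subset (Finset.range_mono hmn)
      have h1 : Tendsto (fun n => ENNReal.ofReal (W τ) +
          expectedPart k γ (optimalBid k W) rate ν (-1) n τ) atTop
          (𝓝 (ENNReal.ofReal (W τ) + N)) := (tendsto_atTop_iSup hmono).const_add _
      have h2 : Tendsto (fun n : ℕ => P + ENNReal.ofReal (rate / (rate + γ)) ^ n *
          ENNReal.ofReal M) atTop (𝓝 (P + 0 * ENNReal.ofReal M)) := by
        refine Tendsto.const_add _ (ENNReal.Tendsto.mul_const
          (ENNReal.tendsto_pow_atTop_nhds_zero_of_lt_one ?_) (Or.inr ENNReal.ofReal_ne_top))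
        rw [ENNReal.ofReal_lt_one, div_lt_one (by positivity)]
        linarith
      rw [zero_mul, add_zero] at h2
      refine le_of_tendsto_of_tendsto' h1 h2 fun n => ?_
      refine (expectedPart_optimal_ge hν hk hrate hγ hWm hW₀
        (fun t => (le_abs_self _).trans (hM t)) hbell n τ).trans ?_
      gcongr
      exact le_iSup (fun n => expectedPart k γ (optimalBid k W) rate ν 1 n τ) n
    -- The optimal bid has a finite expected loss, since it is dominated by the finite gain.
    have hNtop : N ≠ ⊤ := ne_top_of_le_ne_top hPtop (le_add_self.trans hle)
    rw [← hWE, EReal.le_sub_iff_add_le (by simp) (by simp [hNtop]), ← EReal.coe_ennreal_add]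
    exact EReal.coe_ennreal_le_coe_ennreal_iff.2 hle

theorem optimalValue_congr (hrate : 0 < rate) {k k' : ℝ → ℝ} (hk : EqOn k k' (Ici 0)) {τ : ℝ}
    (hτ : 0 ≤ τ) : optimalValue k ν rate γ τ = optimalValue k' ν rate γ τ := by
  simp only [optimalValue, value_congr ν hrate hk γ _ hτ]

end Verification

end RepeatedAuction

end

/-! ### The main theorem -/

theorem mainTheorem2
    (k : ℝ → ℝ) (hk_mono : MonotoneOn k (Ici 0)) (hk_bdd : ∃ K : ℝ, ∀ t, 0 ≤ t → |k t| ≤ K)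
    (ν : Measure ℝ) [IsProbabilityMeasure ν] (hν : ν (Iio 0) = 0)
    (hq : ContinuousOn (fun x => cdf ν x) (Ici 0))
    (rate γ : ℝ) (hrate : 0 < rate) (hγ : 0 < γ) :
    -- for every `v` the problem `F_v` has exactly one solution on `[0, ∞)`
    (∀ v : ℝ, ∃ Z : ℝ → ℝ, RepeatedAuction.IsSelfSolution k (fun x => cdf ν x) rate γ v Z ∧
      ∀ Y : ℝ → ℝ, RepeatedAuction.IsSelfSolution k (fun x => cdf ν x) rate γ v Y →
        EqOn Y Z (Ici 0)) ∧
    -- `V⋆(0)` is a real number, and the unique `v` whose solution has a finite limit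
    ∃ v₀ : ℝ, RepeatedAuction.optimalValue k ν rate γ 0 = (v₀ : EReal) ∧
      ∀ v : ℝ, (∃ Z : ℝ → ℝ, RepeatedAuction.IsSelfSolution k (fun x => cdf ν x) rate γ v Z ∧
        ∃ l : ℝ, Tendsto Z atTop (𝓝 l)) ↔ v = v₀ := by
  obtain ⟨K, hK⟩ := hk_bdd
  -- Extending k by the constant k 0 to the left makes it monotone and bounded on the line;
  -- solutions and values from age 0 only see [0, ∞).
  let κ : ℝ → ℝ := fun t => k (max t 0)
  have hκ : EqOn κ k (Ici 0) := fun t ht => by simp only [κ, max_eq_left (mem_Ici.1 ht)]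
  have hmono : Monotone κ := fun s t hst =>
    hk_mono (le_max_right s 0) (le_max_right t 0) (max_le_max_right 0 hst)
  have hbdd : ∀ t, |κ t| ≤ K := fun t => hK _ (le_max_right t 0)
  have hext : ∀ t, κ (max t 0) = κ t := fun t => by simp [κ]
  constructor
  · intro v
    obtain ⟨Z, hZ⟩ := RepeatedAuction.exists_isSolution ν hmono hbdd hext hrate hγ v v
    exact ⟨Z, hZ.congr_left hκ.symm, fun Y hY =>
      RepeatedAuction.IsSolution.eqOn ν hmono hbdd hrate hγ
        (RepeatedAuction.IsSolution.congr_left hY hκ) hZ⟩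
  · obtain ⟨W, M, hWc, hM, hW⟩ :=
      RepeatedAuction.exists_bellman_solution ν hmono.measurable hbdd hrate hγ
    have hW₀ := RepeatedAuction.nonneg_of_bellman hν hmono.measurable hbdd hrate hγ
      hWc.measurable hM hW
    have hWmono := RepeatedAuction.monotone_of_bellman hmono hbdd hrate hγ hWc.measurable hM hW
    refine ⟨W 0, ?_, fun v => ⟨?_, ?_⟩⟩
    · rw [RepeatedAuction.optimalValue_congr hrate hκ.symm le_rfl]
      exact RepeatedAuction.optimalValue_eq hν hmono.measurable hbdd hrate hγ hWc.measurable
        hW₀ hM hW 0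
    · rintro ⟨Z, hZ, l, hl⟩
      have := RepeatedAuction.IsSelfSolution.eqOn_bellman ν hmono hbdd hrate hγ hWc hM hW
        (RepeatedAuction.IsSolution.congr_left hZ hκ) hl (mem_Ici.2 le_rfl)
      rw [← this, hZ.initial]
    · rintro rfl
      refine ⟨W, RepeatedAuction.IsSolution.congr_left
        (RepeatedAuction.isSelfSolution_of_bellman ν hmono hbdd hext hrate hγ hWc hM hW) hκ.symm,
        _, tendsto_atTop_ciSup hWmono ⟨M, ?_⟩⟩
      rintro _ ⟨t, rfl⟩
      exact (le_abs_self _).trans (hM t)
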